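/- Let $m\ge 1$ be an integer. On the complex Hilbert space $L^2(\mathbb{R})$ consider the operators, both with domain $H^1(\mathbb{R})$, $$L_+ = |\nabla| - \frac{2m}{1+x^2}, \qquad L_- = L_+ + R, \qquad (Rf)(x) = \frac{1}{2\pi}\int_{\mathbb{R}} \frac{|\mathbf{Q}_m(x)-\mathbf{Q}_m(y)|^2}{|x-y|^2}\, f(y)\,dy,$$ where $|\nabla|$ is the Fourier multiplier with symbol $|\xi|$ (for the Fourier transform with kernel $e^{-ix\xi}$) and $\mathbf{Q}_m=(f_m,g_m,0):\mathbb{R}\to\mathbb{S}^2$ is the pure-power half-harmonic map of degree $m$, that is, $$f_m(x)=\mathrm{Re}\Big(i\,\frac{x-i}{x+i}\Big)^m,\qquad g_m(x)=\mathrm{Im}\Big(i\,\frac{x-i}{x+i}\Big)^m .$$ Write $\sigma_{\mathrm p}(T)$ for the set of eigenvalues of $T$ (with eigenfunctions in $H^1(\mathbb{R})$). Then the following hold. (i) $\sigma_{\mathrm p}(L_+)$ consists of exactly $2m$ eigenvalues $E_0,\dots,E_{2m-1}$; each of them is simple (its eigenspace has dimension $1$), and $E_0<E_1<\dots<E_{2m-2}<E_{2m-1}=0$.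 (ii) $\sigma_{\mathrm p}(L_-)=\{0\}$, and the eigenvalue $0$ is exactly $2m$-fold degenerate (its eigenspace has dimension $2m$). In particular, both operators have no embedded eigenvalue $E>0$ inside $\sigma_{\mathrm{ess}}(L_+)=\sigma_{\mathrm{ess}}(L_-)=[0,\infty)$. -/

import Mathlib

open MeasureTheory FourierTransform Filter Topology
open scoped SchwartzMap ENNReal

noncomputable section

namespace HalfWave

/-! ### Point spectrum and essential spectrum of an unbounded operator -/

section Spectrum

variable {H : Type*} [NormedAddCommGroup H] [InnerProductSpace ℂ H]

/-- The set of eigenvalues of an unbounded operator `T`; eigenvectors lie in the domain of `T`. -/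
def pointSpectrum (T : H →ₗ.[ℂ] H) : Set ℂ :=
  {z | ∃ u : T.domain, u ≠ 0 ∧ T u = z • (u : H)}

/-- The eigenspace `{u ∈ dom T : T u = z u}`. -/
def eigenspace (T : H →ₗ.[ℂ] H) (z : ℂ) : Submodule ℂ T.domain :=
  LinearMap.ker (T.toFun - z • T.domain.subtype)

/-- The essential spectrum of a (self-adjoint) operator, through singular Weyl sequences:
normalized sequences `u n ∈ dom T` with `u n ⇀ 0` weakly and `(T - z) u n → 0` in norm. -/
def essentialSpectrum (T : H →ₗ.[ℂ] H) : Set ℂ :=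
  {z | ∃ u : ℕ → T.domain, (∀ n, ‖(u n : H)‖ = 1) ∧
    (∀ v : H, Tendsto (fun n => inner ℂ v (u n : H)) atTop (𝓝 0)) ∧
    Tendsto (fun n => T (u n) - z • (u n : H)) atTop (𝓝 0)}

end Spectrum

/-- The complex Hilbert space `L²(ℝ)`. -/
abbrev L2 : Type := Lp ℂ 2 (volume : Measure ℝ)

/-! ### The Sobolev space `H¹(ℝ)` and the operator `|∇|` -/

/-- The Sobolev space `H¹(ℝ)` as a subspace of `L²(ℝ)`. -/
def H1 : Submodule ℂ L2 where
  carrier := {f | TemperedDistribution.MemSobolev 1 2 (f : 𝓢'(ℝ, ℂ))}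
  add_mem' {f g} hf hg := by
    have h := TemperedDistribution.MemSobolev.add hf hg
    rw [← Lp.toTemperedDistributionCLM_apply, ← Lp.toTemperedDistributionCLM_apply,
      ← map_add] at h
    exact h
  zero_mem' := by
    have h := TemperedDistribution.memSobolev_fun_zero ℝ ℂ 1 2
    rw [← map_zero (Lp.toTemperedDistributionCLM ℂ (volume : Measure ℝ) 2)] at h
    exact h
  smul_mem' c f hf := by
    have h := TemperedDistribution.MemSobolev.smul c hf
    rw [← Lp.toTemperedDistributionCLM_apply, ← map_smul] at h
    exact h

/-- The symbol of `|∇|` for the Fourier transform `𝓕 f ξ = ∫ exp (-2πixξ) f x dx`. -/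
def absSymbol (ξ : ℝ) : ℂ := ((2 * Real.pi * |ξ| : ℝ) : ℂ)

theorem memLp_absSymbol_mul {f : L2} (hf : f ∈ H1) :
    MemLp (fun ξ => absSymbol ξ * (𝓕 f : L2) ξ) 2 (volume : Measure ℝ) := by
  obtain ⟨u, hu⟩ := TemperedDistribution.memSobolev_iff_exists_smulLeftCLM_fourier.mp hf
  -- `b = (1 + ξ²)^(-1/2)` is bounded, and the Fourier transform of `f` is `b u`
  have hbm : MemLp (fun ξ : ℝ => (((1 + ‖ξ‖ ^ 2) ^ (-1 / 2 : ℝ) : ℝ) : ℂ)) ∞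
      (volume : Measure ℝ) := by
    refine memLp_top_of_bound ?_ 1 (Eventually.of_forall fun ξ => ?_)
    · refine Continuous.aestronglyMeasurable ?_
      refine Complex.continuous_ofReal.comp ?_
      exact Continuous.rpow_const (by fun_prop) fun ξ => Or.inl (by positivity)
    · rw [Complex.norm_real, Real.norm_of_nonneg (by positivity)]
      exact Real.rpow_le_one_of_one_le_of_nonpos (le_add_of_nonneg_right (by positivity))
        (by norm_num)
  have key : (𝓕 f : L2) = hbm.toLp • u := by
    have hinj := LinearMap.ker_eq_bot.mp
      (Lp.ker_toTemperedDistributionCLM_eq_bot (F := ℂ) (E := ℝ) (p := 2)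
        (μ := (volume : Measure ℝ)))
    apply hinj
    change Lp.toTemperedDistributionCLM ℂ volume 2 _ = Lp.toTemperedDistributionCLM ℂ volume 2 _
    rw [Lp.toTemperedDistributionCLM_apply, Lp.toTemperedDistributionCLM_apply,
      Lp.toTemperedDistribution_smul_eq (by fun_prop), ← hu,
      TemperedDistribution.smulLeftCLM_smulLeftCLM_apply (by fun_prop) (by fun_prop),
      Lp.fourier_toTemperedDistribution_eq]
    symm
    convert TemperedDistribution.smulLeftCLM_const (1 : ℂ) ((𝓕 f : L2) : 𝓢'(ℝ, ℂ)) using 1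
    · congr 2
      ext ξ
      rw [Pi.mul_apply, ← Complex.ofReal_mul, ← Real.rpow_add (by positivity)]
      norm_num
    · simp
  refine MemLp.of_le_mul (c := 2 * Real.pi) (Lp.memLp u) ?_ ?_
  · refine AEStronglyMeasurable.mul ?_ (Lp.aestronglyMeasurable _)
    refine Continuous.aestronglyMeasurable ?_
    unfold absSymbol
    fun_prop
  · have h1 : ((𝓕 f : L2) : ℝ → ℂ) =ᵐ[volume] ((hbm.toLp • u : L2) : ℝ → ℂ) := by rw [key]
    filter_upwards [h1, Lp.coeFn_lpSMul (r := 2) hbm.toLp u, hbm.coeFn_toLp] with ξ e1 e2 e3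
    rw [e1, e2, Pi.smul_apply', e3, smul_eq_mul, norm_mul, norm_mul, absSymbol,
      Complex.norm_real, Complex.norm_real, Real.norm_of_nonneg (by positivity),
      Real.norm_of_nonneg (by positivity), ← mul_assoc, mul_assoc (2 * Real.pi)]
    refine mul_le_mul_of_nonneg_right ?_ (norm_nonneg _)
    refine mul_le_of_le_one_right (by positivity) ?_
    have h2 : |ξ| ≤ (1 + ‖ξ‖ ^ 2) ^ (1 / 2 : ℝ) := by
      rw [← Real.sqrt_eq_rpow]
      refine Real.le_sqrt_of_sq_le ?_
      rw [Real.norm_eq_abs]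
      linarith
    calc |ξ| * (1 + ‖ξ‖ ^ 2) ^ (-1 / 2 : ℝ)
        ≤ (1 + ‖ξ‖ ^ 2) ^ (1 / 2 : ℝ) * (1 + ‖ξ‖ ^ 2) ^ (-1 / 2 : ℝ) :=
          mul_le_mul_of_nonneg_right h2 (by positivity)
      _ = 1 := by
          rw [← Real.rpow_add (by positivity)]
          norm_num

/-- `|∇| : H¹(ℝ) → L²(ℝ)`, the Fourier multiplier with symbol `2π|ξ|`. -/
def absNabla : H1 →ₗ[ℂ] L2 where
  toFun f := 𝓕⁻ ((memLp_absSymbol_mul f.2).toLp _ : L2)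
  map_add' f g := by
    rw [← FourierTransform.fourierInv_add]
    congr 1
    apply Lp.ext
    have h : ((𝓕 ((f + g : H1) : L2) : L2) : ℝ → ℂ) =ᵐ[volume]
        ((𝓕 (f : L2) + 𝓕 (g : L2) : L2) : ℝ → ℂ) := by
      rw [Submodule.coe_add, FourierTransform.fourier_add]
    filter_upwards [h, (memLp_absSymbol_mul (f + g).2).coeFn_toLp,
      (memLp_absSymbol_mul f.2).coeFn_toLp, (memLp_absSymbol_mul g.2).coeFn_toLp,
      Lp.coeFn_add ((memLp_absSymbol_mul f.2).toLp _) ((memLp_absSymbol_mul g.2).toLp _),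
      Lp.coeFn_add (𝓕 (f : L2) : L2) (𝓕 (g : L2) : L2)] with ξ h1 h2 h3 h4 h5 h6
    rw [h2, h1, h5, h6, Pi.add_apply, Pi.add_apply, h3, h4, mul_add]
  map_smul' c f := by
    rw [RingHom.id_apply, ← FourierTransform.fourierInv_smul]
    congr 1
    apply Lp.ext
    have h : ((𝓕 ((c • f : H1) : L2) : L2) : ℝ → ℂ) =ᵐ[volume]
        ((c • 𝓕 (f : L2) : L2) : ℝ → ℂ) := by
      rw [Submodule.coe_smul, FourierTransform.fourier_smul]
    filter_upwards [h, (memLp_absSymbol_mul (c • f).2).coeFn_toLp,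
      (memLp_absSymbol_mul f.2).coeFn_toLp,
      Lp.coeFn_smul c ((memLp_absSymbol_mul f.2).toLp _),
      Lp.coeFn_smul c (𝓕 (f : L2) : L2)] with ξ h1 h2 h3 h4 h5
    rw [h2, h1, h4, h5, Pi.smul_apply, Pi.smul_apply, h3, smul_eq_mul, smul_eq_mul]
    ring

/-! ### The potential `2m/(1+x²)` -/

/-- The potential `2m/(1+x²)`. -/
def potential (m : ℕ) (x : ℝ) : ℝ := 2 * m / (1 + x ^ 2)

theorem memLp_potential_mul (m : ℕ) (f : L2) :
    MemLp (fun x => (potential m x : ℂ) * f x) 2 (volume : Measure ℝ) := by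
  refine MemLp.of_le_mul (c := 2 * m) (Lp.memLp f) ?_ (Eventually.of_forall fun x => ?_)
  · refine AEStronglyMeasurable.mul ?_ (Lp.aestronglyMeasurable _)
    refine Measurable.aestronglyMeasurable ?_
    unfold potential
    fun_prop
  · rw [norm_mul, potential, Complex.norm_real, Real.norm_of_nonneg (by positivity)]
    refine mul_le_mul_of_nonneg_right ?_ (norm_nonneg _)
    exact div_le_self (by positivity) (by nlinarith [sq_nonneg x])

/-- Multiplication by `2m/(1+x²)` on `L²(ℝ)`. -/
def potentialOp (m : ℕ) : L2 →ₗ[ℂ] L2 where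
  toFun f := (memLp_potential_mul m f).toLp _
  map_add' f g := by
    apply Lp.ext
    filter_upwards [(memLp_potential_mul m (f + g)).coeFn_toLp,
      (memLp_potential_mul m f).coeFn_toLp, (memLp_potential_mul m g).coeFn_toLp,
      Lp.coeFn_add ((memLp_potential_mul m f).toLp _) ((memLp_potential_mul m g).toLp _),
      Lp.coeFn_add f g] with x h1 h2 h3 h4 h5
    rw [h1, h4, h5, Pi.add_apply, Pi.add_apply, h2, h3, mul_add]
  map_smul' c f := by
    apply Lp.ext
    filter_upwards [(memLp_potential_mul m (c • f)).coeFn_toLp,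
      (memLp_potential_mul m f).coeFn_toLp,
      Lp.coeFn_smul c ((memLp_potential_mul m f).toLp _),
      Lp.coeFn_smul c f] with x h1 h2 h3 h4
    rw [RingHom.id_apply, h1, h3, h4, Pi.smul_apply, Pi.smul_apply, h2, smul_eq_mul, smul_eq_mul]
    ring

/-! ### The half-harmonic map `Q_m` and the integral operator `R` -/

/-- `f_k(x) = Re (i (x - i)/(x + i))^k`. -/
def fFun (k : ℕ) (x : ℝ) : ℝ :=
  ((Complex.I * (((x : ℂ) - Complex.I) / ((x : ℂ) + Complex.I))) ^ k).re

/-- `g_k(x) = Im (i (x - i)/(x + i))^k`. -/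
def gFun (k : ℕ) (x : ℝ) : ℝ :=
  ((Complex.I * (((x : ℂ) - Complex.I) / ((x : ℂ) + Complex.I))) ^ k).im

/-- The pure-power half-harmonic map `Q_m = (f_m, g_m, 0)` of degree `m`. -/
def Q (m : ℕ) (x : ℝ) : EuclideanSpace ℝ (Fin 3) := !₂[fFun m x, gFun m x, 0]

/-- The integral kernel `(1/2π) |Q_m(x) - Q_m(y)|² / |x - y|²`. -/
def kernelR (m : ℕ) (x y : ℝ) : ℝ :=
  1 / (2 * Real.pi) * (‖Q m x - Q m y‖ ^ 2 / |x - y| ^ 2)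

theorem kernelR_eq (m : ℕ) (x y : ℝ) :
    kernelR m x y = 1 / (2 * Real.pi) *
      (‖(Complex.I * (((x : ℂ) - Complex.I) / ((x : ℂ) + Complex.I))) ^ m -
        (Complex.I * (((y : ℂ) - Complex.I) / ((y : ℂ) + Complex.I))) ^ m‖ ^ 2 / |x - y| ^ 2) := by
  rw [kernelR, EuclideanSpace.norm_sq_eq, Complex.sq_norm, Complex.normSq_apply, Fin.sum_univ_three]
  simp [Q, fFun, gFun, pow_two]

theorem measurable_kernelR (m : ℕ) : Measurable fun p : ℝ × ℝ => kernelR m p.1 p.2 := by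
  simp only [kernelR_eq]
  fun_prop

theorem norm_sub_I_sq (x : ℝ) : ‖(x : ℂ) - Complex.I‖ ^ 2 = 1 + x ^ 2 := by
  rw [Complex.sq_norm, Complex.normSq_apply]
  simp
  ring

theorem norm_add_I_sq (x : ℝ) : ‖(x : ℂ) + Complex.I‖ ^ 2 = 1 + x ^ 2 := by
  rw [Complex.sq_norm, Complex.normSq_apply]
  simp
  ring

theorem add_I_ne_zero (x : ℝ) : (x : ℂ) + Complex.I ≠ 0 := by
  intro h
  have h1 := norm_add_I_sq x
  rw [h, norm_zero] at h1
  nlinarith [sq_nonneg x]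

theorem norm_cayley (x : ℝ) :
    ‖Complex.I * (((x : ℂ) - Complex.I) / ((x : ℂ) + Complex.I))‖ = 1 := by
  have h1 : ‖Complex.I * (((x : ℂ) - Complex.I) / ((x : ℂ) + Complex.I))‖ ^ 2 = 1 := by
    rw [norm_mul, norm_div, Complex.norm_I, one_mul, div_pow, norm_sub_I_sq, norm_add_I_sq]
    exact div_self (by positivity)
  exact (pow_eq_one_iff_of_nonneg (norm_nonneg _) two_ne_zero).mp h1

theorem norm_cayley_sub_sq (x y : ℝ) :
    ‖Complex.I * (((x : ℂ) - Complex.I) / ((x : ℂ) + Complex.I)) -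
      Complex.I * (((y : ℂ) - Complex.I) / ((y : ℂ) + Complex.I))‖ ^ 2 =
      4 * |x - y| ^ 2 * ((1 + x ^ 2)⁻¹ * (1 + y ^ 2)⁻¹) := by
  have hx := add_I_ne_zero x
  have hy := add_I_ne_zero y
  have h : Complex.I * (((x : ℂ) - Complex.I) / ((x : ℂ) + Complex.I)) -
      Complex.I * (((y : ℂ) - Complex.I) / ((y : ℂ) + Complex.I)) =
      (-2 * ((x - y : ℝ) : ℂ)) / (((x : ℂ) + Complex.I) * ((y : ℂ) + Complex.I)) := by
    field_simp
    push_cast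
    linear_combination (2 * ((x : ℂ) - y)) * Complex.I_sq
  rw [h, norm_div, norm_mul, norm_mul, div_pow, mul_pow, mul_pow, norm_add_I_sq, norm_add_I_sq,
    Complex.norm_real, Real.norm_eq_abs, div_eq_mul_inv, mul_inv]
  norm_num

theorem norm_pow_sub_pow_le {a b : ℂ} (ha : ‖a‖ = 1) (hb : ‖b‖ = 1) (m : ℕ) :
    ‖a ^ m - b ^ m‖ ≤ m * ‖a - b‖ := by
  induction m with
  | zero => simp
  | succ k ih =>
    have h : a ^ (k + 1) - b ^ (k + 1) = a ^ k * (a - b) + (a ^ k - b ^ k) * b := by ring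
    calc ‖a ^ (k + 1) - b ^ (k + 1)‖ ≤ ‖a ^ k * (a - b)‖ + ‖(a ^ k - b ^ k) * b‖ := by
          rw [h]; exact norm_add_le _ _
      _ = ‖a - b‖ + ‖a ^ k - b ^ k‖ := by
          rw [norm_mul, norm_mul, norm_pow, ha, hb, one_pow, one_mul, mul_one]
      _ ≤ ‖a - b‖ + k * ‖a - b‖ := by gcongr
      _ = ((k + 1 : ℕ) : ℝ) * ‖a - b‖ := by push_cast; ring

theorem kernelR_nonneg (m : ℕ) (x y : ℝ) : 0 ≤ kernelR m x y := by
  unfold kernelR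
  positivity

theorem kernelR_le (m : ℕ) (x y : ℝ) :
    kernelR m x y ≤ 2 * m ^ 2 / Real.pi * ((1 + x ^ 2)⁻¹ * (1 + y ^ 2)⁻¹) := by
  rcases eq_or_ne x y with rfl | hxy
  · have h : kernelR m x x = 0 := by simp [kernelR]
    rw [h]
    positivity
  have hpos : 0 < |x - y| ^ 2 := by
    have := abs_pos.mpr (sub_ne_zero.mpr hxy)
    positivity
  rw [kernelR_eq]
  have h1 := pow_le_pow_left₀ (norm_nonneg _)
    (norm_pow_sub_pow_le (norm_cayley x) (norm_cayley y) m) 2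
  rw [mul_pow (m : ℝ), norm_cayley_sub_sq] at h1
  calc _ ≤ 1 / (2 * Real.pi) *
        ((m : ℝ) ^ 2 * (4 * |x - y| ^ 2 * ((1 + x ^ 2)⁻¹ * (1 + y ^ 2)⁻¹)) / |x - y| ^ 2) := by
        gcongr
    _ = _ := by
        have := Real.pi_pos
        field_simp
        ring

theorem memLp_inv_one_add_sq : MemLp (fun x : ℝ => (1 + x ^ 2)⁻¹) 2 (volume : Measure ℝ) := by
  have hm : AEStronglyMeasurable (fun x : ℝ => (1 + x ^ 2)⁻¹) (volume : Measure ℝ) :=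
    Measurable.aestronglyMeasurable (by fun_prop)
  rw [memLp_two_iff_integrable_sq hm]
  refine Integrable.mono' integrable_inv_one_add_sq (hm.pow 2) (Eventually.of_forall fun x => ?_)
  have h1 : (1 + x ^ 2)⁻¹ ≤ 1 := inv_le_one_of_one_le₀ (by nlinarith [sq_nonneg x])
  have h0 : 0 ≤ (1 + x ^ 2)⁻¹ := by positivity
  rw [Real.norm_of_nonneg (by positivity)]
  nlinarith

theorem integrable_weight_mul (f : L2) :
    Integrable (fun y => (1 + y ^ 2)⁻¹ * ‖f y‖) (volume : Measure ℝ) :=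
  memLp_inv_one_add_sq.integrable_mul (Lp.memLp f).norm

theorem norm_kernelR_mul_le (m : ℕ) (f : L2) (x y : ℝ) :
    ‖(kernelR m x y : ℂ) * f y‖ ≤
      2 * m ^ 2 / Real.pi * (1 + x ^ 2)⁻¹ * ((1 + y ^ 2)⁻¹ * ‖f y‖) := by
  rw [norm_mul, Complex.norm_real, Real.norm_of_nonneg (kernelR_nonneg m x y)]
  calc _ ≤ 2 * m ^ 2 / Real.pi * ((1 + x ^ 2)⁻¹ * (1 + y ^ 2)⁻¹) * ‖f y‖ :=
        mul_le_mul_of_nonneg_right (kernelR_le m x y) (norm_nonneg _)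
    _ = _ := by ring

theorem integrable_kernelR (m : ℕ) (f : L2) (x : ℝ) :
    Integrable (fun y => (kernelR m x y : ℂ) * f y) (volume : Measure ℝ) := by
  refine Integrable.mono' ((integrable_weight_mul f).const_mul
    (2 * m ^ 2 / Real.pi * (1 + x ^ 2)⁻¹)) ?_
    (Eventually.of_forall fun y => norm_kernelR_mul_le m f x y)
  refine AEStronglyMeasurable.mul ?_ (Lp.aestronglyMeasurable _)
  exact (Complex.measurable_ofReal.comp
    ((measurable_kernelR m).comp measurable_prodMk_left)).aestronglyMeasurable

theorem memLp_kernelR (m : ℕ) (f : L2) :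
    MemLp (fun x => ∫ y, (kernelR m x y : ℂ) * f y) 2 (volume : Measure ℝ) := by
  refine MemLp.of_le_mul (c := 2 * m ^ 2 / Real.pi * ∫ y, (1 + y ^ 2)⁻¹ * ‖f y‖)
    memLp_inv_one_add_sq ?_ (Eventually.of_forall fun x => ?_)
  · refine AEStronglyMeasurable.integral_prod_right'
      (f := fun p : ℝ × ℝ => (kernelR m p.1 p.2 : ℂ) * f p.2) ?_
    refine AEStronglyMeasurable.mul ?_ ?_
    · exact (Complex.measurable_ofReal.comp (measurable_kernelR m)).aestronglyMeasurable
    · exact (Lp.aestronglyMeasurable f).comp_snd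
  · calc ‖∫ y, (kernelR m x y : ℂ) * f y‖
        ≤ ∫ y, 2 * m ^ 2 / Real.pi * (1 + x ^ 2)⁻¹ * ((1 + y ^ 2)⁻¹ * ‖f y‖) :=
          norm_integral_le_of_norm_le ((integrable_weight_mul f).const_mul _)
            (Eventually.of_forall fun y => norm_kernelR_mul_le m f x y)
      _ = _ := by
          rw [integral_const_mul, Real.norm_of_nonneg (by positivity)]
          ring

/-- The integral operator `(R f)(x) = (1/2π) ∫ |Q_m(x) - Q_m(y)|² / |x - y|² f(y) dy`. -/
def opR (m : ℕ) : L2 →ₗ[ℂ] L2 where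
  toFun f := (memLp_kernelR m f).toLp _
  map_add' f g := by
    apply Lp.ext
    filter_upwards [(memLp_kernelR m (f + g)).coeFn_toLp,
      (memLp_kernelR m f).coeFn_toLp, (memLp_kernelR m g).coeFn_toLp,
      Lp.coeFn_add ((memLp_kernelR m f).toLp _) ((memLp_kernelR m g).toLp _)] with x h1 h2 h3 h4
    rw [h1, h4, Pi.add_apply, h2, h3,
      ← integral_add (integrable_kernelR m f x) (integrable_kernelR m g x)]
    refine integral_congr_ae ?_
    filter_upwards [Lp.coeFn_add f g] with y hy
    rw [hy, Pi.add_apply, mul_add]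
  map_smul' c f := by
    apply Lp.ext
    filter_upwards [(memLp_kernelR m (c • f)).coeFn_toLp, (memLp_kernelR m f).coeFn_toLp,
      Lp.coeFn_smul c ((memLp_kernelR m f).toLp _)] with x h1 h2 h3
    rw [RingHom.id_apply, h1, h3, Pi.smul_apply, h2, smul_eq_mul, ← integral_const_mul]
    refine integral_congr_ae ?_
    filter_upwards [Lp.coeFn_smul c f] with y hy
    rw [hy, Pi.smul_apply, smul_eq_mul]
    ring

/-! ### The operators `L₊` and `L₋` -/

/-- `L₊ = |∇| - 2m/(1+x²)` on `L²(ℝ)` with domain `H¹(ℝ)`. -/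
def Lplus (m : ℕ) : L2 →ₗ.[ℂ] L2 where
  domain := H1
  toFun := absNabla - potentialOp m ∘ₗ H1.subtype

/-- `L₋ = L₊ + R` on `L²(ℝ)` with domain `H¹(ℝ)`. -/
def Lminus (m : ℕ) : L2 →ₗ.[ℂ] L2 where
  domain := (Lplus m).domain
  toFun := (Lplus m).toFun + opR m ∘ₗ (Lplus m).domain.subtype

end HalfWave

end

/-!
On the Hardy space of frequencies of sign `σ`, `|∇|` is `σ` times the momentum `-i d/dx`, and the
momentum of the power `((x - i)/(x + i))ᵐ` of the Cayley transform is `2m/(1 + x²)` times that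
power. Conjugating by these powers therefore turns `L₊` into the momentum up to sign, which has no
square integrable eigenfunctions. Since `R` has finite rank, the same applies to `L₋`, and all
eigenfunctions lie in the span of `(x - i)ⁿ/(x + i)ⁿ⁺¹`, `-m ≤ n < m`. There `L₋` vanishes, so that
`L₊ = -R`. In this basis `L₊` is a Jacobi matrix, whence its eigenvalues are simple; they are
nonpositive because `R` is a combination of rank one projections with nonnegative Fejér
coefficients, and the sum of the basis lies in the kernel of `R`. The essential spectra are that of
`|∇|` because the potential is relatively compact and `R` is compact.
-/

noncomputable section

namespace HalfWave

open scoped BoundedContinuousFunction ComplexConjugate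

/-! ### The Fourier transform of integrable square integrable functions -/

section Fourier

variable {E F : Type*} [NormedAddCommGroup E] [InnerProductSpace ℝ E] [FiniteDimensional ℝ E]
  [MeasurableSpace E] [BorelSpace E]

theorem ae_eq_of_forall_integral_schwartz_smul_eq [NormedAddCommGroup F] [NormedSpace ℂ F]
    [CompleteSpace F] {f g : E → F} (hf : LocallyIntegrable f) (hg : LocallyIntegrable g)
    (h : ∀ ψ : 𝓢(E, ℂ), ∫ x, ψ x • f x = ∫ x, ψ x • g x) : f =ᵐ[volume] g := by
  refine ae_eq_of_integral_contDiff_smul_eq hf hg fun φ φ_smooth φ_cpt => ?_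
  have hcpt : HasCompactSupport (Complex.ofRealCLM ∘ φ) := φ_cpt.comp_left rfl
  have hsmooth : ContDiff ℝ (⊤ : ℕ∞) (Complex.ofRealCLM ∘ φ) := by fun_prop
  simpa using h (hcpt.toSchwartzMap hsmooth)

variable [NormedAddCommGroup F] [InnerProductSpace ℂ F] [CompleteSpace F]

theorem fourier_toLp_ae_eq {g : E → F} (hg : Integrable g) (hg₂ : MemLp g 2) :
    ((𝓕 (hg₂.toLp g) : Lp F 2) : E → F) =ᵐ[volume] 𝓕 g := by
  have hcont : Continuous (𝓕 g) :=
    VectorFourier.fourierIntegral_continuous Real.continuous_fourierChar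
      (by exact continuous_inner) hg
  refine ae_eq_of_forall_integral_schwartz_smul_eq
    ((Lp.memLp _).locallyIntegrable one_le_two) hcont.locallyIntegrable fun ψ => ?_
  rw [← Lp.toTemperedDistribution_apply, ← Lp.fourier_toTemperedDistribution_eq,
    TemperedDistribution.fourier_apply, Lp.toTemperedDistribution_apply]
  calc ∫ x, 𝓕 ψ x • hg₂.toLp g x = ∫ x, 𝓕 ψ x • g x :=
        integral_congr_ae (by filter_upwards [hg₂.coeFn_toLp] with x hx; rw [hx])
    _ = ∫ x, ψ x • 𝓕 g x := by
        rw [SchwartzMap.fourier_coe]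
        simpa using! VectorFourier.integral_fourierIntegral_smul_eq_flip (L := innerₗ E)
          Real.continuous_fourierChar continuous_inner ψ.integrable hg

theorem fourierInv_toLp_ae_eq {g : E → F} (hg : Integrable g) (hg₂ : MemLp g 2) :
    ((𝓕⁻ (hg₂.toLp g) : Lp F 2) : E → F) =ᵐ[volume] 𝓕⁻ g := by
  have hcont : Continuous (𝓕⁻ g) :=
    VectorFourier.fourierIntegral_continuous Real.continuous_fourierChar
      (L := -innerₗ E) (by exact continuous_inner.neg) hg
  have hflip : (-innerₗ E).flip = -innerₗ E := by
    ext
    simp [real_inner_comm]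
  refine ae_eq_of_forall_integral_schwartz_smul_eq
    ((Lp.memLp _).locallyIntegrable one_le_two) hcont.locallyIntegrable fun ψ => ?_
  rw [← Lp.toTemperedDistribution_apply, ← Lp.fourierInv_toTemperedDistribution_eq,
    TemperedDistribution.fourierInv_apply, Lp.toTemperedDistribution_apply]
  calc ∫ x, 𝓕⁻ ψ x • hg₂.toLp g x = ∫ x, 𝓕⁻ ψ x • g x :=
        integral_congr_ae (by filter_upwards [hg₂.coeFn_toLp] with x hx; rw [hx])
    _ = ∫ x, ψ x • 𝓕⁻ g x := by
        rw [SchwartzMap.fourierInv_coe]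
        have := VectorFourier.integral_fourierIntegral_smul_eq_flip (L := -innerₗ E)
          Real.continuous_fourierChar continuous_inner.neg (ψ.integrable (μ := volume)) hg
        rwa [hflip] at this

end Fourier

/-! ### Multiplication operators -/

section Multiplication

variable {α : Type*} [TopologicalSpace α] [MeasurableSpace α] [OpensMeasurableSpace α]
  {μ : Measure α}

theorem memLp_boundedContinuous_mul {p : ℝ≥0∞} (q : α →ᵇ ℂ) (f : Lp ℂ p μ) :
    MemLp (fun x => q x * f x) p μ :=
  MemLp.of_le_mul (Lp.memLp f) (q.continuous.aestronglyMeasurable.mul (Lp.aestronglyMeasurable f))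
    (Eventually.of_forall fun x => by
      rw [norm_mul]
      exact mul_le_mul_of_nonneg_right (q.norm_coe_le_norm x) (norm_nonneg _))

/-- Multiplication by a bounded continuous function as an operator on `L²(μ)`, before its algebraic
properties in `q` are recorded in `mulL2`. -/
def mulOperator (q : α →ᵇ ℂ) : Lp ℂ 2 μ →L[ℂ] Lp ℂ 2 μ :=
  LinearMap.mkContinuous
    { toFun := fun f => (memLp_boundedContinuous_mul q f).toLp _
      map_add' := fun f g => by
        rw [← MemLp.toLp_add, MemLp.toLp_eq_toLp_iff]
        filter_upwards [Lp.coeFn_add f g] with x hx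
        simp only [hx, Pi.add_apply, mul_add]
      map_smul' := fun c f => by
        rw [RingHom.id_apply, ← MemLp.toLp_const_smul, MemLp.toLp_eq_toLp_iff]
        filter_upwards [Lp.coeFn_smul c f] with x hx
        simp only [hx, Pi.smul_apply, smul_eq_mul, mul_left_comm] }
    ‖q‖ fun f => by
      refine Lp.norm_le_mul_norm_of_ae_le_mul ?_
      filter_upwards [(memLp_boundedContinuous_mul q f).coeFn_toLp] with x hx
      change ‖(memLp_boundedContinuous_mul q f).toLp _ x‖ ≤ _
      rw [hx, norm_mul]
      exact mul_le_mul_of_nonneg_right (q.norm_coe_le_norm x) (norm_nonneg _)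

theorem coeFn_mulOperator (q : α →ᵇ ℂ) (f : Lp ℂ 2 μ) : mulOperator q f =ᵐ[μ] fun x => q x * f x :=
  (memLp_boundedContinuous_mul q f).coeFn_toLp

theorem ext_mulOperator {q : α →ᵇ ℂ} {T : Lp ℂ 2 μ →L[ℂ] Lp ℂ 2 μ}
    (h : ∀ f, T f =ᵐ[μ] fun x => q x * f x) : mulOperator q = T :=
  ContinuousLinearMap.ext fun f => Lp.ext ((coeFn_mulOperator q f).trans (h f).symm)

theorem inner_mulOperator_left (q : α →ᵇ ℂ) (f g : Lp ℂ 2 μ) :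
    inner ℂ (mulOperator q f) g = inner ℂ f (mulOperator (star q) g) := by
  rw [L2.inner_def, L2.inner_def]
  refine integral_congr_ae ?_
  filter_upwards [coeFn_mulOperator q f, coeFn_mulOperator (star q) g] with x h1 h2
  simp only [h1, h2, RCLike.inner_apply, map_mul, BoundedContinuousFunction.star_apply,
    RCLike.star_def]
  ring

/-- The representation of the bounded continuous functions on `L²(μ)` by multiplication. -/
def mulL2 : (α →ᵇ ℂ) →⋆ₐ[ℂ] (Lp ℂ 2 μ →L[ℂ] Lp ℂ 2 μ) where
  toFun := mulOperator
  map_one' := ext_mulOperator fun f => by simp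
  map_mul' p q := ext_mulOperator fun f => by
    filter_upwards [coeFn_mulOperator p (mulOperator q f), coeFn_mulOperator q f] with x hp hq
    simp only [mul_apply_eq_comp, hp, hq, BoundedContinuousFunction.mul_apply,
      mul_assoc]
  map_zero' := ext_mulOperator fun f => by
    filter_upwards [Lp.coeFn_zero ℂ 2 μ] with x hx
    simpa using hx
  map_add' p q := ext_mulOperator fun f => by
    filter_upwards [coeFn_mulOperator p f, coeFn_mulOperator q f,
      Lp.coeFn_add (mulOperator p f) (mulOperator q f)] with x hp hq hpq
    simp only [add_apply, hpq, Pi.add_apply, hp, hq,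
      BoundedContinuousFunction.add_apply, add_mul]
  commutes' c := ext_mulOperator fun f => by
    filter_upwards [Lp.coeFn_smul c f] with x hx
    simpa [Algebra.algebraMap_eq_smul_one] using hx
  map_star' q := by
    rw [ContinuousLinearMap.star_eq_adjoint, ContinuousLinearMap.eq_adjoint_iff]
    intro f g
    rw [inner_mulOperator_left, star_star]

theorem coeFn_mulL2 (q : α →ᵇ ℂ) (f : Lp ℂ 2 μ) : mulL2 q f =ᵐ[μ] fun x => q x * f x :=
  coeFn_mulOperator q f

theorem mulL2_toLp {p q r : α →ᵇ ℂ} (hq : MemLp q 2 μ) (hr : MemLp r 2 μ) (h : p * q = r) :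
    mulL2 p (hq.toLp q) = hr.toLp r := by
  refine Lp.ext ?_
  filter_upwards [coeFn_mulL2 p (hq.toLp q), hq.coeFn_toLp, hr.coeFn_toLp] with x h1 h2 h3
  rw [h1, h2, h3, ← h, BoundedContinuousFunction.mul_apply]

theorem mulL2_mul_apply (p q : α →ᵇ ℂ) (f : Lp ℂ 2 μ) : mulL2 (p * q) f = mulL2 p (mulL2 q f) := by
  rw [map_mul, mul_apply_eq_comp]

theorem inner_mulL2_left (q : α →ᵇ ℂ) (f g : Lp ℂ 2 μ) :
    inner ℂ (mulL2 q f) g = inner ℂ f (mulL2 (star q) g) :=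
  inner_mulOperator_left q f g

end Multiplication

/-! ### Products and convolutions -/

/-- The bounded continuous function `q` is the inverse Fourier transform of `κ ∈ L¹ ∩ L²`;
multiplication by `q` is then convolution by `κ` on the Fourier side. -/
structure IsFourierPair (κ : ℝ → ℂ) (q : ℝ →ᵇ ℂ) : Prop where
  integrable : Integrable κ
  memLp : MemLp κ 2
  eq_fourierInv : ∀ x, q x = 𝓕⁻ κ x

namespace IsFourierPair

variable {κ : ℝ → ℂ} {q : ℝ →ᵇ ℂ}

theorem coeFn_fourierInv_toLp (h : IsFourierPair κ q) :
    ((𝓕⁻ (h.memLp.toLp κ) : L2) : ℝ → ℂ) =ᵐ[volume] q := by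
  filter_upwards [fourierInv_toLp_ae_eq h.integrable h.memLp] with x hx
  rw [hx, h.eq_fourierInv]

theorem memLp_right (h : IsFourierPair κ q) : MemLp q 2 :=
  (memLp_congr_ae h.coeFn_fourierInv_toLp).1 (Lp.memLp _)

theorem fourier_toLp (h : IsFourierPair κ q) : 𝓕 (h.memLp_right.toLp q) = h.memLp.toLp κ := by
  have heq : h.memLp_right.toLp q = (𝓕⁻ (h.memLp.toLp κ) : L2) :=
    Lp.ext (h.memLp_right.coeFn_toLp.trans h.coeFn_fourierInv_toLp.symm)
  rw [heq, fourier_fourierInv_eq]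

theorem memLp_reflect (h : IsFourierPair κ q) (ξ : ℝ) : MemLp (fun η => conj (κ (ξ - η))) 2 :=
  (h.memLp.comp_measurePreserving (Measure.measurePreserving_sub_left volume ξ)).star

theorem integrable_reflect (h : IsFourierPair κ q) (ξ : ℝ) :
    Integrable (fun η => conj (κ (ξ - η))) :=
  memLp_one_iff_integrable.1 ((memLp_one_iff_integrable.2 h.integrable).comp_measurePreserving
    (Measure.measurePreserving_sub_left volume ξ)).star

theorem fourierInv_reflect (h : IsFourierPair κ q) (ξ x : ℝ) :
    𝓕⁻ (fun η => conj (κ (ξ - η))) x =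
      conj (Complex.exp ((-2 * Real.pi * (ξ * x) : ℝ) * Complex.I) * q x) := by
  rw [h.eq_fourierInv, Real.fourierInv_eq', Real.fourierInv_eq', map_mul, ← integral_conj,
    ← integral_const_mul, ← integral_sub_left_eq_self _ volume ξ]
  refine integral_congr_ae (Eventually.of_forall fun y => ?_)
  simp only [smul_eq_mul, map_mul, ← Complex.exp_conj, sub_sub_cancel, RCLike.inner_apply,
    conj_trivial, Complex.conj_I, Complex.conj_ofReal]
  rw [← mul_assoc (Complex.exp _) (Complex.exp _), ← Complex.exp_add]
  congr 2
  push_cast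
  ring

-- At each frequency both sides are the inner product of `f` with `𝓕⁻ (conj κ(ξ - ·))`.
theorem fourier_mulL2 (h : IsFourierPair κ q) (f : L2) :
    ((𝓕 (mulL2 q f) : L2) : ℝ → ℂ) =ᵐ[volume] fun ξ => ∫ η, κ (ξ - η) * (𝓕 f : L2) η := by
  have hint : Integrable (fun x => q x * f x) := h.memLp_right.integrable_mul (Lp.memLp f)
  filter_upwards [fourier_toLp_ae_eq hint (memLp_boundedContinuous_mul q f)] with ξ hξ
  calc (𝓕 (mulL2 q f) : L2) ξ
      = ∫ x, Complex.exp ((-2 * Real.pi * (ξ * x) : ℝ) * Complex.I) * (q x * f x) := by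
        refine hξ.trans ?_
        simp [Real.fourier_eq']
    _ = inner ℂ (𝓕⁻ ((h.memLp_reflect ξ).toLp _) : L2) f := by
        rw [L2.inner_def]
        refine integral_congr_ae ?_
        filter_upwards [fourierInv_toLp_ae_eq (h.integrable_reflect ξ) (h.memLp_reflect ξ)]
          with x hx
        rw [hx, h.fourierInv_reflect, RCLike.inner_apply, Complex.conj_conj]
        ring
    _ = inner ℂ ((h.memLp_reflect ξ).toLp _ : L2) (𝓕 f : L2) := by
        rw [← Lp.inner_fourier_eq, fourier_fourierInv_eq]
    _ = ∫ η, κ (ξ - η) * (𝓕 f : L2) η := by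
        rw [L2.inner_def]
        refine integral_congr_ae ?_
        filter_upwards [(h.memLp_reflect ξ).coeFn_toLp] with η hη
        rw [hη, RCLike.inner_apply, Complex.conj_conj, mul_comm]

end IsFourierPair

/-! ### The momentum operator, the Hardy spaces and `H¹` -/

theorem coeFn_fourier_add (u v : L2) :
    ((𝓕 (u + v) : L2) : ℝ → ℂ) =ᵐ[volume] fun ξ => (𝓕 u : L2) ξ + (𝓕 v : L2) ξ := by
  rw [FourierTransform.fourier_add]
  exact Lp.coeFn_add _ _

theorem coeFn_fourier_smul (c : ℂ) (u : L2) :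
    ((𝓕 (c • u) : L2) : ℝ → ℂ) =ᵐ[volume] fun ξ => c * (𝓕 u : L2) ξ := by
  rw [FourierTransform.fourier_smul]
  exact Lp.coeFn_smul _ _

theorem L2_ext_fourier {f g : L2} (h : ((𝓕 f : L2) : ℝ → ℂ) =ᵐ[volume] (𝓕 g : L2)) : f = g :=
  (Lp.fourierTransformₗᵢ ℝ ℂ).injective (Lp.ext h)

theorem inner_eq_integral_fourier (f g : L2) :
    inner ℂ f g = ∫ ξ, (𝓕 g : L2) ξ * conj ((𝓕 f : L2) ξ) := by
  rw [← Lp.inner_fourier_eq, L2.inner_def]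
  rfl

/-- `v = -i u'`, the momentum of `u`, expressed through Fourier transforms. A relation rather than
an operator, so that no domain has to be carried around; `u` then lies in `H¹`. -/
def HasMomentum (u v : L2) : Prop :=
  ((𝓕 v : L2) : ℝ → ℂ) =ᵐ[volume] fun ξ => ((2 * Real.pi * ξ : ℝ) : ℂ) * (𝓕 u : L2) ξ

namespace HasMomentum

variable {u v u' v' : L2}

theorem add (h : HasMomentum u v) (h' : HasMomentum u' v') : HasMomentum (u + u') (v + v') := by
  filter_upwards [h, h', coeFn_fourier_add u u', coeFn_fourier_add v v'] with ξ h1 h2 h3 h4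
  rw [h4, h3, h1, h2, mul_add]

theorem smul (c : ℂ) (h : HasMomentum u v) : HasMomentum (c • u) (c • v) := by
  filter_upwards [h, coeFn_fourier_smul c u, coeFn_fourier_smul c v] with ξ h1 h2 h3
  rw [h3, h2, h1, mul_left_comm]

theorem memLp_besselSymbol_mul (h : HasMomentum u v) :
    MemLp (fun ξ : ℝ => (((1 + ‖ξ‖ ^ 2) ^ ((1 : ℝ) / 2) : ℝ) : ℂ) * (𝓕 u : L2) ξ) 2 := by
  refine MemLp.of_le ((Lp.memLp (𝓕 u : L2)).norm.add (Lp.memLp (𝓕 v : L2)).norm) ?_ ?_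
  · have hcont : Continuous fun ξ : ℝ => (1 + ‖ξ‖ ^ 2) ^ ((1 : ℝ) / 2) :=
      Continuous.rpow_const (by fun_prop) fun ξ => Or.inl (by positivity)
    exact (Complex.continuous_ofReal.comp hcont).aestronglyMeasurable.mul
      (Lp.aestronglyMeasurable _)
  · filter_upwards [h] with ξ hξ
    have hsqrt : √(1 + ‖ξ‖ ^ 2) ≤ 1 + 2 * Real.pi * ‖ξ‖ := by
      refine Real.sqrt_le_iff.2 ⟨by positivity, ?_⟩
      have hle : ‖ξ‖ ≤ 2 * Real.pi * ‖ξ‖ :=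
        le_mul_of_one_le_left (norm_nonneg ξ) (by linarith [Real.pi_gt_three])
      nlinarith [norm_nonneg ξ]
    have hnorm : ‖2 * Real.pi * ξ‖ = 2 * Real.pi * ‖ξ‖ := by
      rw [norm_mul, Real.norm_of_nonneg (by positivity)]
    calc ‖(((1 + ‖ξ‖ ^ 2) ^ ((1 : ℝ) / 2) : ℝ) : ℂ) * (𝓕 u : L2) ξ‖
        = √(1 + ‖ξ‖ ^ 2) * ‖(𝓕 u : L2) ξ‖ := by
          rw [norm_mul, Complex.norm_real, ← Real.sqrt_eq_rpow,
            Real.norm_of_nonneg (Real.sqrt_nonneg _)]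
      _ ≤ (1 + 2 * Real.pi * ‖ξ‖) * ‖(𝓕 u : L2) ξ‖ := by gcongr
      _ = ‖(𝓕 u : L2) ξ‖ + ‖(𝓕 v : L2) ξ‖ := by
          rw [hξ, norm_mul, Complex.norm_real, hnorm, add_mul, one_mul]
      _ ≤ _ := le_abs_self _

theorem mem_H1 (h : HasMomentum u v) : u ∈ H1 := by
  refine TemperedDistribution.memSobolev_iff_exists_smulLeftCLM_fourier.mpr
    ⟨h.memLp_besselSymbol_mul.toLp _, ?_⟩
  rw [Lp.fourier_toTemperedDistribution_eq]
  ext φ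
  rw [TemperedDistribution.smulLeftCLM_apply_apply, Lp.toTemperedDistribution_apply,
    Lp.toTemperedDistribution_apply]
  refine integral_congr_ae ?_
  filter_upwards [h.memLp_besselSymbol_mul.coeFn_toLp] with ξ hξ
  rw [hξ, SchwartzMap.smulLeftCLM_apply_apply (by fun_prop)]
  simp only [smul_eq_mul]
  ring

end HasMomentum

theorem exists_hasMomentum_of_memLp {u : L2}
    (h : MemLp (fun ξ => ((2 * Real.pi * ξ : ℝ) : ℂ) * (𝓕 u : L2) ξ) 2) :
    ∃ v, HasMomentum u v := by
  refine ⟨𝓕⁻ (h.toLp _), ?_⟩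
  rw [HasMomentum, fourier_fourierInv_eq]
  exact h.coeFn_toLp

theorem exists_hasMomentum (f : H1) : ∃ g, HasMomentum (f : L2) g := by
  refine exists_hasMomentum_of_memLp (MemLp.of_le (memLp_absSymbol_mul f.2) ?_ ?_)
  · exact (Continuous.aestronglyMeasurable (by fun_prop)).mul (Lp.aestronglyMeasurable _)
  · exact Eventually.of_forall fun ξ => by simp [absSymbol]

theorem exists_hasMomentum_of_ae_eq_zero {u : L2} {R : ℝ}
    (h : ∀ᵐ ξ, R < |ξ| → (𝓕 u : L2) ξ = 0) : ∃ v, HasMomentum u v := by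
  refine exists_hasMomentum_of_memLp
    (MemLp.of_le_mul (c := 2 * Real.pi * R) (Lp.memLp (𝓕 u : L2)) ?_ ?_)
  · exact (Continuous.aestronglyMeasurable (by fun_prop)).mul (Lp.aestronglyMeasurable _)
  · filter_upwards [h] with ξ hξ
    by_cases hR : R < |ξ|
    · simp [hξ hR]
    · rw [norm_mul, Complex.norm_real, norm_mul, Real.norm_of_nonneg (by positivity),
        Real.norm_eq_abs]
      gcongr
      exact not_lt.1 hR

/-- The Hardy space of functions with Fourier transform supported on `{σ ξ ≥ 0}`; only `σ = ±1` is
used, for functions with an analytic extension to the upper or lower half plane. -/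
def hardy (σ : ℝ) : Submodule ℂ L2 where
  carrier := {f | ∀ᵐ ξ, σ * ξ < 0 → (𝓕 f : L2) ξ = 0}
  add_mem' {f g} hf hg := by
    filter_upwards [hf, hg, coeFn_fourier_add f g] with ξ h1 h2 h3 h
    rw [h3, h1 h, h2 h, add_zero]
  zero_mem' := by
    filter_upwards [coeFn_fourier_smul 0 0] with ξ hξ _
    rw [← zero_smul ℂ (0 : L2), hξ, zero_mul]
  smul_mem' c f hf := by
    filter_upwards [hf, coeFn_fourier_smul c f] with ξ h1 h2 h
    rw [h2, h1 h, mul_zero]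

theorem mem_hardy {σ : ℝ} {f : L2} :
    f ∈ hardy σ ↔ ∀ᵐ ξ, σ * ξ < 0 → (𝓕 f : L2) ξ = 0 := Iff.rfl

theorem inner_eq_zero_of_hardy {f g : L2} (hf : f ∈ hardy (-1)) (hg : g ∈ hardy 1) :
    inner ℂ f g = 0 := by
  rw [inner_eq_integral_fourier]
  refine integral_eq_zero_of_ae ?_
  have hne : ∀ᵐ ξ : ℝ, ξ ≠ 0 := by simp [ae_iff]
  filter_upwards [hf, hg, hne] with ξ h1 h2 h3
  rcases lt_or_gt_of_ne h3 with h | h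
  · simp [h2 (by linarith)]
  · simp [h1 (by linarith)]

theorem eq_zero_of_hardy {f : L2} (hf : f ∈ hardy (-1)) (hg : f ∈ hardy 1) : f = 0 :=
  inner_self_eq_zero.1 (inner_eq_zero_of_hardy (f := f) hf hg)

/-! ### The operator `|∇|` -/

theorem coeFn_fourier_absNabla (f : H1) :
    ((𝓕 (absNabla f) : L2) : ℝ → ℂ) =ᵐ[volume] fun ξ => absSymbol ξ * (𝓕 (f : L2) : L2) ξ := by
  change ((𝓕 (𝓕⁻ ((memLp_absSymbol_mul f.2).toLp _ : L2) : L2) : L2) : ℝ → ℂ) =ᵐ[volume] _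
  rw [fourier_fourierInv_eq]
  exact (memLp_absSymbol_mul f.2).coeFn_toLp

theorem absNabla_of_hardy {σ : ℝ} (hσ : |σ| = 1) {f : H1} {g : L2} (h : HasMomentum (f : L2) g)
    (hf : (f : L2) ∈ hardy σ) : absNabla f = (σ : ℂ) • g := by
  refine L2_ext_fourier ?_
  filter_upwards [coeFn_fourier_absNabla f, coeFn_fourier_smul σ g, h, hf] with ξ h1 h2 h3 h4
  rw [h1, h2, h3]
  by_cases hξ : σ * ξ < 0
  · simp [h4 hξ]
  · have habs : |ξ| = σ * ξ := by
      rw [← abs_of_nonneg (not_lt.1 hξ), abs_mul, hσ, one_mul]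
    rw [absSymbol, habs]
    push_cast
    ring

theorem norm_absNabla_eq {f : H1} {g : L2} (h : HasMomentum (f : L2) g) : ‖absNabla f‖ = ‖g‖ := by
  rw [← Lp.norm_fourier_eq, ← Lp.norm_fourier_eq g]
  have hξ : ∀ᵐ ξ, ‖(𝓕 (absNabla f) : L2) ξ‖ = ‖(𝓕 g : L2) ξ‖ := by
    filter_upwards [coeFn_fourier_absNabla f, h] with ξ h1 h2
    simp [h1, h2, absSymbol]
  exact le_antisymm (Lp.norm_le_norm_of_ae_le (hξ.mono fun _ => le_of_eq))
    (Lp.norm_le_norm_of_ae_le (hξ.mono fun _ => ge_of_eq))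

theorem absNabla_symmetric (f g : H1) :
    inner ℂ (absNabla f) (g : L2) = inner ℂ (f : L2) (absNabla g) := by
  rw [inner_eq_integral_fourier, inner_eq_integral_fourier]
  refine integral_congr_ae ?_
  filter_upwards [coeFn_fourier_absNabla f, coeFn_fourier_absNabla g] with ξ h1 h2
  rw [h1, h2, map_mul, absSymbol, Complex.conj_ofReal]
  ring

/-! ### Multiplication by inverse Fourier transforms -/

namespace IsFourierPair

variable {κ : ℝ → ℂ} {q q₁ : ℝ →ᵇ ℂ}

theorem integrable_conv (h : IsFourierPair κ q) (f : L2) (ξ : ℝ) :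
    Integrable (fun η => κ (ξ - η) * f η) :=
  (h.memLp.comp_measurePreserving
    (Measure.measurePreserving_sub_left volume ξ)).integrable_mul (Lp.memLp f)

theorem star (h : IsFourierPair κ q) : IsFourierPair (fun ξ => conj (κ (-ξ))) (star q) where
  integrable := by simpa using h.integrable_reflect 0
  memLp := by simpa using h.memLp_reflect 0
  eq_fourierInv x := by simpa using (h.fourierInv_reflect 0 x).symm

theorem smul (c : ℂ) (h : IsFourierPair κ q) : IsFourierPair (fun ξ => c * κ ξ) (c • q) where
  integrable := h.integrable.const_mul c
  memLp := h.memLp.const_mul c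
  eq_fourierInv x := by
    rw [BoundedContinuousFunction.smul_apply, h.eq_fourierInv, Real.fourierInv_eq,
      Real.fourierInv_eq, ← integral_smul]
    simp only [Circle.smul_def, smul_eq_mul, mul_left_comm]

theorem mulL2_mem_hardy (h : IsFourierPair κ q) {σ : ℝ} (hκ : ∀ ξ, σ * ξ < 0 → κ ξ = 0)
    {f : L2} (hf : f ∈ hardy σ) : mulL2 q f ∈ hardy σ := by
  filter_upwards [h.fourier_mulL2 f] with ξ hξ hneg
  rw [hξ]
  refine integral_eq_zero_of_ae ?_
  filter_upwards [hf] with η hη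
  by_cases h1 : σ * η < 0
  · simp [hη h1]
  · rw [hκ (ξ - η) (by linarith), zero_mul]
    rfl

theorem toLp_mem_hardy (h : IsFourierPair κ q) {σ : ℝ} (hκ : ∀ ξ, σ * ξ < 0 → κ ξ = 0) :
    h.memLp_right.toLp q ∈ hardy σ := by
  rw [mem_hardy, h.fourier_toLp]
  filter_upwards [h.memLp.coeFn_toLp] with ξ hξ hneg
  rw [hξ, hκ ξ hneg]

theorem hasMomentum_toLp (h : IsFourierPair κ q)
    (h₁ : IsFourierPair (fun ξ => ((2 * Real.pi * ξ : ℝ) : ℂ) * κ ξ) q₁) :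
    HasMomentum (h.memLp_right.toLp q) (h₁.memLp_right.toLp q₁) := by
  rw [HasMomentum, h.fourier_toLp, h₁.fourier_toLp]
  filter_upwards [h.memLp.coeFn_toLp, h₁.memLp.coeFn_toLp] with ξ e1 e2
  rw [e1, e2]

theorem hasMomentum_mulL2 (h : IsFourierPair κ q)
    (h₁ : IsFourierPair (fun ξ => ((2 * Real.pi * ξ : ℝ) : ℂ) * κ ξ) q₁) {f g : L2}
    (hf : HasMomentum f g) : HasMomentum (mulL2 q f) (mulL2 q g + mulL2 q₁ f) := by
  filter_upwards [coeFn_fourier_add (mulL2 q g) (mulL2 q₁ f), h.fourier_mulL2 f,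
    h.fourier_mulL2 g, h₁.fourier_mulL2 f] with ξ e1 e2 e3 e4
  rw [e1, e2, e3, e4, ← integral_add (h.integrable_conv _ ξ) (h₁.integrable_conv _ ξ),
    ← integral_const_mul]
  refine integral_congr_ae ?_
  filter_upwards [hf] with η hη
  rw [hη]
  push_cast
  ring

end IsFourierPair

/-! ### The Cayley transform -/

theorem sub_I_ne_zero (x : ℝ) : (x : ℂ) - Complex.I ≠ 0 := by
  have h := add_I_ne_zero (-x)
  contrapose! h
  push_cast
  linear_combination -h

/-- The function `1 / (x + i)`. -/
def invAddI : ℝ →ᵇ ℂ :=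
  BoundedContinuousFunction.ofNormedAddCommGroup (fun x : ℝ => ((x : ℂ) + Complex.I)⁻¹)
    (Continuous.inv₀ (by fun_prop) add_I_ne_zero) 1 fun x => by
      rw [norm_inv]
      refine inv_le_one_of_one_le₀ ?_
      nlinarith [norm_add_I_sq x, sq_nonneg x, norm_nonneg ((x : ℂ) + Complex.I)]

@[simp] theorem invAddI_apply (x : ℝ) : invAddI x = ((x : ℂ) + Complex.I)⁻¹ := rfl

@[simp] theorem star_invAddI_apply (x : ℝ) : (star invAddI) x = ((x : ℂ) - Complex.I)⁻¹ := by
  simp [sub_eq_add_neg]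

theorem invAddI_mul_star_apply (x : ℝ) :
    (invAddI * star invAddI) x = (((1 + x ^ 2)⁻¹ : ℝ) : ℂ) := by
  rw [BoundedContinuousFunction.mul_apply, invAddI_apply, star_invAddI_apply, ← mul_inv]
  push_cast
  congr 1
  linear_combination -Complex.I_sq

theorem star_invAddI_sub_invAddI :
    star invAddI - invAddI = (2 * Complex.I) • (invAddI * star invAddI) := by
  ext x
  simp only [BoundedContinuousFunction.sub_apply, BoundedContinuousFunction.smul_apply,
    BoundedContinuousFunction.mul_apply, invAddI_apply, star_invAddI_apply, smul_eq_mul]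
  rw [inv_sub_inv (sub_I_ne_zero x) (add_I_ne_zero x), div_eq_mul_inv, mul_inv]
  ring

/-- The Cayley transform `(x - i) / (x + i)`, a unit with inverse its complex conjugate. -/
def cayley : (ℝ →ᵇ ℂ)ˣ :=
  Units.mkOfMulEqOne (1 - (2 * Complex.I) • invAddI) (1 + (2 * Complex.I) • star invAddI) <| by
    rw [← sub_eq_zero]
    calc (1 - (2 * Complex.I) • invAddI) * (1 + (2 * Complex.I) • star invAddI) - 1
        = (2 * Complex.I) •
          (star invAddI - invAddI - (2 * Complex.I) • (invAddI * star invAddI)) := by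
          simp only [sub_mul, mul_add, smul_mul_assoc, mul_smul_comm, one_mul, mul_one]
          module
      _ = 0 := by rw [star_invAddI_sub_invAddI, sub_self, smul_zero]

theorem cayley_val : (cayley : ℝ →ᵇ ℂ) = 1 - (2 * Complex.I) • invAddI := rfl

theorem cayley_inv : ((cayley⁻¹ : (ℝ →ᵇ ℂ)ˣ) : ℝ →ᵇ ℂ) = 1 + (2 * Complex.I) • star invAddI := rfl

theorem cayley_apply (x : ℝ) :
    (cayley : ℝ →ᵇ ℂ) x = ((x : ℂ) - Complex.I) / ((x : ℂ) + Complex.I) := by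
  simp only [cayley_val, BoundedContinuousFunction.sub_apply, BoundedContinuousFunction.coe_one,
    Pi.one_apply, BoundedContinuousFunction.smul_apply, invAddI_apply, smul_eq_mul]
  field_simp [add_I_ne_zero x]
  ring

theorem norm_cayley_apply (x : ℝ) : ‖(cayley : ℝ →ᵇ ℂ) x‖ = 1 := by
  have h := norm_cayley x
  rwa [norm_mul, Complex.norm_I, one_mul, ← cayley_apply] at h

theorem cayley_zpow_apply (n : ℤ) (x : ℝ) :
    ((cayley ^ n : (ℝ →ᵇ ℂ)ˣ) : ℝ →ᵇ ℂ) x = (cayley : ℝ →ᵇ ℂ) x ^ n := by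
  let ev : (ℝ →ᵇ ℂ) →* ℂ := { toFun := fun f => f x, map_one' := rfl, map_mul' := fun _ _ => rfl }
  change ((Units.map ev (cayley ^ n) : ℂˣ) : ℂ) = ((Units.map ev cayley : ℂˣ) : ℂ) ^ n
  rw [map_zpow, Units.val_zpow_eq_zpow_val]

theorem star_cayley : star (cayley : ℝ →ᵇ ℂ) = ((cayley⁻¹ : (ℝ →ᵇ ℂ)ˣ) : ℝ →ᵇ ℂ) := by
  simp [cayley_val, cayley_inv]

theorem star_cayley_zpow (n : ℤ) :
    star ((cayley ^ n : (ℝ →ᵇ ℂ)ˣ) : ℝ →ᵇ ℂ) = ((cayley ^ (-n) : (ℝ →ᵇ ℂ)ˣ) : ℝ →ᵇ ℂ) := by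
  have h : star cayley = cayley⁻¹ := Units.ext star_cayley
  rw [← Units.coe_star, star_zpow, h, inv_zpow, zpow_neg]

theorem star_invAddI_mul_cayley : star invAddI * (cayley : ℝ →ᵇ ℂ) = invAddI := by
  ext x
  rw [BoundedContinuousFunction.mul_apply, cayley_apply, star_invAddI_apply, invAddI_apply,
    div_eq_mul_inv, inv_mul_cancel_left₀ (sub_I_ne_zero x)]

theorem invAddI_mul_cayley_inv :
    invAddI * ((cayley⁻¹ : (ℝ →ᵇ ℂ)ˣ) : ℝ →ᵇ ℂ) = star invAddI := by
  rw [Units.mul_inv_eq_iff_eq_mul, star_invAddI_mul_cayley]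

theorem I_smul_invAddI : Complex.I • invAddI = (1 / 2 : ℂ) • (1 - (cayley : ℝ →ᵇ ℂ)) := by
  rw [cayley_val]
  module

theorem invAddI_mul_star :
    invAddI * star invAddI =
      (1 / 4 : ℂ) • ((2 : ℂ) • 1 - (cayley : ℝ →ᵇ ℂ) - (cayley⁻¹ : (ℝ →ᵇ ℂ)ˣ)) := by
  have h : invAddI * star invAddI = (-(Complex.I / 2)) • (star invAddI - invAddI) := by
    rw [star_invAddI_sub_invAddI, smul_smul]
    ring_nf
    simp
  rw [h, cayley_val, cayley_inv]
  module

/-! ### The Fourier transform of `1 / (x + i)` -/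

section ExponentialIntegrals

variable {r : ℂ}

theorem integrableOn_pow_mul_cexp (n : ℕ) (hr : 0 < r.re) :
    IntegrableOn (fun ξ : ℝ => (ξ : ℂ) ^ n * Complex.exp (-r * ξ)) (Set.Ioi 0) := by
  have hreal : IntegrableOn (fun ξ : ℝ => ξ ^ n * Real.exp (-r.re * ξ)) (Set.Ioi 0) := by
    simpa using integrableOn_rpow_mul_exp_neg_mul_rpow (s := n) (p := 1)
      (neg_one_lt_zero.trans_le n.cast_nonneg) one_pos hr
  refine Integrable.mono' hreal (Continuous.aestronglyMeasurable (by fun_prop)) ?_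
  filter_upwards [self_mem_ae_restrict measurableSet_Ioi] with ξ hξ
  rw [norm_mul, norm_pow, Complex.norm_real, Real.norm_of_nonneg (le_of_lt hξ), Complex.norm_exp]
  simp

theorem hasDerivAt_pow_mul_cexp (n : ℕ) (r : ℂ) (x : ℝ) :
    HasDerivAt (fun ξ : ℝ => (ξ : ℂ) ^ (n + 1) * Complex.exp (-r * ξ))
      ((n + 1) * ((x : ℂ) ^ n * Complex.exp (-r * x)) -
        r * ((x : ℂ) ^ (n + 1) * Complex.exp (-r * x))) x := by
  have hexp : HasDerivAt (fun z : ℂ => Complex.exp (-r * z)) (Complex.exp (-r * x) * -r) x := by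
    simpa using ((hasDerivAt_id (x : ℂ)).const_mul (-r)).cexp
  refine (((hasDerivAt_pow (n + 1) (x : ℂ)).mul hexp).comp_ofReal).congr_deriv ?_
  push_cast
  ring

theorem integral_pow_succ_mul_cexp (n : ℕ) (hr : 0 < r.re) :
    r * ∫ ξ : ℝ in Set.Ioi 0, (ξ : ℂ) ^ (n + 1) * Complex.exp (-r * ξ) =
      (n + 1) * ∫ ξ : ℝ in Set.Ioi 0, (ξ : ℂ) ^ n * Complex.exp (-r * ξ) := by
  have hn := (integrableOn_pow_mul_cexp n hr).const_mul ((n : ℂ) + 1)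
  have hsucc := integrableOn_pow_mul_cexp (n + 1) hr
  have hint := hn.sub (hsucc.const_mul r)
  have hderiv : ∀ x ∈ Set.Ici (0 : ℝ), HasDerivAt _ _ x := fun x _ => hasDerivAt_pow_mul_cexp n r x
  have hlim := tendsto_zero_of_hasDerivAt_of_integrableOn_Ioi (a := 0)
    (fun x hx => hderiv x (Set.mem_Ici_of_Ioi hx)) hint hsucc
  have h := integral_Ioi_of_hasDerivAt_of_tendsto' hderiv hint hlim
  rw [integral_sub hn (hsucc.const_mul r), integral_const_mul, integral_const_mul] at h
  simp only [Complex.ofReal_zero, ne_eq, Nat.add_eq_zero_iff, one_ne_zero, and_false,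
    not_false_eq_true, zero_pow, zero_mul, sub_self] at h
  linear_combination -h

theorem integral_pow_mul_cexp (n : ℕ) (hr : 0 < r.re) :
    ∫ ξ : ℝ in Set.Ioi 0, (ξ : ℂ) ^ n * Complex.exp (-r * ξ) = n.factorial * r⁻¹ ^ (n + 1) := by
  have hr0 : r ≠ 0 := by
    rintro rfl
    simp at hr
  induction n with
  | zero =>
    simp only [pow_zero, one_mul]
    rw [integral_exp_mul_complex_Ioi (by simpa using hr)]
    simp [neg_div_neg_eq]
  | succ n ih =>
    refine mul_left_cancel₀ hr0 ?_
    rw [integral_pow_succ_mul_cexp n hr, ih, Nat.factorial_succ, pow_succ _ (n + 1)]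
    push_cast
    field_simp

end ExponentialIntegrals

/-- The function `ξ ^ n * exp (-2πξ)` on the half line `ξ > 0`, whose inverse Fourier transform is a
multiple of `1 / (x + i) ^ (n + 1)`. -/
def gammaKernel (n : ℕ) : ℝ → ℂ :=
  (Set.Ioi 0).indicator fun ξ => (ξ : ℂ) ^ n * Complex.exp (-(2 * Real.pi) * ξ)

theorem integrable_gammaKernel (n : ℕ) : Integrable (gammaKernel n) :=
  (integrable_indicator_iff measurableSet_Ioi).2
    (integrableOn_pow_mul_cexp n (by simp [Real.pi_pos]))

theorem memLp_gammaKernel (n : ℕ) : MemLp (gammaKernel n) 2 := by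
  have hmeas : AEStronglyMeasurable (gammaKernel n) :=
    (integrable_gammaKernel n).aestronglyMeasurable
  have hsq : IntegrableOn (fun ξ : ℝ => (ξ : ℂ) ^ (2 * n) * Complex.exp (-(4 * Real.pi) * ξ))
      (Set.Ioi 0) := integrableOn_pow_mul_cexp (2 * n) (by simp [Real.pi_pos])
  rw [memLp_two_iff_integrable_sq_norm hmeas]
  refine ((integrable_indicator_iff measurableSet_Ioi).2 hsq).norm.congr (ae_of_all _ fun ξ => ?_)
  simp only [gammaKernel, norm_indicator_eq_indicator_norm]
  by_cases hξ : ξ ∈ Set.Ioi (0 : ℝ)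
  · simp only [Set.indicator_of_mem hξ]
    rw [← norm_pow, mul_pow, ← pow_mul, ← Complex.exp_nat_mul]
    ring_nf
  · simp [Set.indicator_of_notMem hξ]

theorem isFourierPair_gammaKernel (n : ℕ) :
    IsFourierPair (gammaKernel n)
      ((n.factorial : ℂ) • ((Complex.I / (2 * Real.pi)) • invAddI) ^ (n + 1)) where
  integrable := integrable_gammaKernel n
  memLp := memLp_gammaKernel n
  eq_fourierInv x := by
    have hr : 0 < (2 * Real.pi * (1 - x * Complex.I) : ℂ).re := by simp [Real.pi_pos]
    have hinv : (2 * Real.pi * (1 - x * Complex.I) : ℂ)⁻¹ =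
        Complex.I / (2 * Real.pi) * ((x : ℂ) + Complex.I)⁻¹ := by
      have hx : (1 : ℂ) - x * Complex.I = Complex.I⁻¹ * (x + Complex.I) := by
        rw [Complex.inv_I]
        linear_combination Complex.I_sq
      rw [hx, mul_inv, mul_inv Complex.I⁻¹, inv_inv, div_eq_mul_inv]
      ring
    simp only [BoundedContinuousFunction.smul_apply, BoundedContinuousFunction.pow_apply,
      invAddI_apply, smul_eq_mul]
    rw [← hinv, ← integral_pow_mul_cexp n hr, ← integral_indicator measurableSet_Ioi,
      Real.fourierInv_eq']
    refine integral_congr_ae (ae_of_all _ fun ξ => ?_)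
    by_cases hξ : ξ ∈ Set.Ioi (0 : ℝ)
    · simp only [gammaKernel, Set.indicator_of_mem hξ, smul_eq_mul, RCLike.inner_apply,
        conj_trivial]
      rw [mul_left_comm, ← Complex.exp_add]
      congr 2
      push_cast
      ring
    · simp [gammaKernel, Set.indicator_of_notMem hξ]

/-- The Fourier transform of `1 / (x + i)`. -/
def expKernel (ξ : ℝ) : ℂ := -(2 * Real.pi * Complex.I) * gammaKernel 0 ξ

theorem expKernel_of_neg {ξ : ℝ} (h : ξ < 0) : expKernel ξ = 0 := by
  simp [expKernel, gammaKernel, h.le]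

theorem isFourierPair_expKernel : IsFourierPair expKernel invAddI := by
  have h := (isFourierPair_gammaKernel 0).smul (-(2 * Real.pi * Complex.I))
  have hc : -(2 * Real.pi * Complex.I) * (Complex.I / (2 * Real.pi)) = 1 := by
    have hπ : (Real.pi : ℂ) ≠ 0 := Complex.ofReal_ne_zero.2 Real.pi_ne_zero
    field_simp
    simp
  rwa [Nat.factorial_zero, Nat.cast_one, one_smul, zero_add, pow_one, smul_smul, hc, one_smul] at h

theorem isFourierPair_mul_expKernel :
    IsFourierPair (fun ξ => ((2 * Real.pi * ξ : ℝ) : ℂ) * expKernel ξ)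
      (Complex.I • (invAddI * invAddI)) := by
  have h := (isFourierPair_gammaKernel 1).smul (-((2 * Real.pi) ^ 2 * Complex.I))
  convert h using 1
  · ext ξ
    by_cases hξ : ξ ∈ Set.Ioi (0 : ℝ)
    · simp only [expKernel, gammaKernel, Set.indicator_of_mem hξ]
      push_cast
      ring
    · simp [expKernel, gammaKernel, Set.indicator_of_notMem hξ]
  · have hc : -((2 * Real.pi) ^ 2 * Complex.I) * (Complex.I / (2 * Real.pi)) ^ 2 = Complex.I := by
      have hπ : (Real.pi : ℂ) ≠ 0 := Complex.ofReal_ne_zero.2 Real.pi_ne_zero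
      rw [div_pow, Complex.I_sq]
      field_simp
    rw [Nat.factorial_one, Nat.cast_one, one_smul, smul_pow, smul_smul, one_add_one_eq_two, hc, sq]

theorem isFourierPair_mul_star_expKernel :
    IsFourierPair (fun ξ => ((2 * Real.pi * ξ : ℝ) : ℂ) * conj (expKernel (-ξ)))
      (Complex.I • (star invAddI * star invAddI)) := by
  have h := isFourierPair_mul_expKernel.star.smul (-1)
  convert h using 1
  · ext ξ
    rw [map_mul, Complex.conj_ofReal]
    push_cast
    ring
  · simp [star_smul, star_mul]

/-! ### Multiplication by powers of the Cayley transform -/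

/-- Multiplication by the `n`-th power of the Cayley transform. -/
def cayleyMul (n : ℤ) : L2 →L[ℂ] L2 := mulL2 ((cayley ^ n : (ℝ →ᵇ ℂ)ˣ) : ℝ →ᵇ ℂ)

theorem cayleyMul_zero (f : L2) : cayleyMul 0 f = f := by
  simp [cayleyMul]

theorem cayleyMul_add (a b : ℤ) (f : L2) : cayleyMul (a + b) f = cayleyMul a (cayleyMul b f) := by
  rw [cayleyMul, zpow_add, Units.val_mul, mulL2_mul_apply, cayleyMul, cayleyMul]

theorem cayleyMul_one (f : L2) : cayleyMul 1 f = f - (2 * Complex.I) • mulL2 invAddI f := by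
  simp [cayleyMul, cayley_val]

theorem cayleyMul_neg_one (f : L2) :
    cayleyMul (-1) f = f + (2 * Complex.I) • mulL2 (star invAddI) f := by
  rw [cayleyMul, zpow_neg_one, cayley_inv, map_add, map_one, map_smul]
  rfl

theorem cayleyMul_neg_cayleyMul (n : ℤ) (f : L2) : cayleyMul (-n) (cayleyMul n f) = f := by
  rw [← cayleyMul_add, neg_add_cancel, cayleyMul_zero]

theorem cayleyMul_cayleyMul_neg (n : ℤ) (f : L2) : cayleyMul n (cayleyMul (-n) f) = f := by
  rw [← cayleyMul_add, add_neg_cancel, cayleyMul_zero]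

theorem mulL2_cayleyMul_comm (q : ℝ →ᵇ ℂ) (n : ℤ) (f : L2) :
    mulL2 q (cayleyMul n f) = cayleyMul n (mulL2 q f) := by
  rw [cayleyMul, ← mulL2_mul_apply, mul_comm, mulL2_mul_apply]

theorem inner_cayleyMul_left (n : ℤ) (f g : L2) :
    inner ℂ (cayleyMul n f) g = inner ℂ f (cayleyMul (-n) g) := by
  rw [cayleyMul, inner_mulL2_left, star_cayley_zpow, cayleyMul]

theorem mulL2_invAddI_mem_hardy_one {f : L2} (hf : f ∈ hardy 1) : mulL2 invAddI f ∈ hardy 1 :=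
  isFourierPair_expKernel.mulL2_mem_hardy (fun ξ h => expKernel_of_neg (by linarith)) hf

theorem mulL2_star_invAddI_mem_hardy_neg_one {f : L2} (hf : f ∈ hardy (-1)) :
    mulL2 (star invAddI) f ∈ hardy (-1) :=
  isFourierPair_expKernel.star.mulL2_mem_hardy
    (fun ξ h => by rw [expKernel_of_neg (by linarith), map_zero]) hf

theorem cayleyMul_mem_hardy_one {n : ℤ} (hn : 0 ≤ n) {f : L2} (hf : f ∈ hardy 1) :
    cayleyMul n f ∈ hardy 1 := by
  induction n, hn using Int.leInduction with
  | base => rwa [cayleyMul_zero]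
  | succ n hn ih =>
    rw [add_comm, cayleyMul_add, cayleyMul_one]
    exact sub_mem ih (Submodule.smul_mem _ _ (mulL2_invAddI_mem_hardy_one ih))

theorem cayleyMul_mem_hardy_neg_one {n : ℤ} (hn : n ≤ 0) {f : L2} (hf : f ∈ hardy (-1)) :
    cayleyMul n f ∈ hardy (-1) := by
  induction n, hn using Int.leInductionDown with
  | base => rwa [cayleyMul_zero]
  | pred n hn ih =>
    rw [sub_eq_add_neg, add_comm, cayleyMul_add, cayleyMul_neg_one]
    exact add_mem ih (Submodule.smul_mem _ _ (mulL2_star_invAddI_mem_hardy_neg_one ih))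

/-- Multiplication by `1 / (1 + x²)`, the logarithmic derivative of the Cayley transform up to the
factor `2i`. -/
def weightMul : L2 →L[ℂ] L2 := mulL2 (invAddI * star invAddI)

theorem weightMul_cayleyMul (n : ℤ) (f : L2) :
    weightMul (cayleyMul n f) = cayleyMul n (weightMul f) :=
  mulL2_cayleyMul_comm _ n f

theorem weightMul_eq (f : L2) :
    weightMul f = (1 / 4 : ℂ) • ((2 : ℂ) • f - cayleyMul 1 f - cayleyMul (-1) f) := by
  rw [weightMul, invAddI_mul_star, map_smul, map_sub, map_sub, map_smul, map_one, cayleyMul,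
    cayleyMul, zpow_one, zpow_neg_one]
  rfl

theorem HasMomentum.cayleyMul_one {f g : L2} (h : HasMomentum f g) :
    HasMomentum (cayleyMul 1 f) (cayleyMul 1 g + (2 : ℂ) • weightMul (cayleyMul 1 f)) := by
  have hadd := h.add ((isFourierPair_expKernel.hasMomentum_mulL2 isFourierPair_mul_expKernel h).smul
    (-(2 * Complex.I)))
  convert hadd using 1
  · rw [HalfWave.cayleyMul_one]
    module
  · have hsq : weightMul (cayleyMul 1 f) = mulL2 (invAddI * invAddI) f := by
      rw [weightMul, cayleyMul, zpow_one, ← mulL2_mul_apply, mul_assoc, star_invAddI_mul_cayley]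
    have hI : -(2 * Complex.I) * Complex.I = 2 := by linear_combination (-2) * Complex.I_sq
    rw [hsq, HalfWave.cayleyMul_one g, map_smul, smul_apply, smul_add, smul_smul, hI]
    module

theorem HasMomentum.cayleyMul_neg_one {f g : L2} (h : HasMomentum f g) :
    HasMomentum (cayleyMul (-1) f)
      (cayleyMul (-1) g + (-2 : ℂ) • weightMul (cayleyMul (-1) f)) := by
  have hadd := h.add
    ((isFourierPair_expKernel.star.hasMomentum_mulL2 isFourierPair_mul_star_expKernel h).smul
      (2 * Complex.I))
  convert hadd using 1
  · rw [HalfWave.cayleyMul_neg_one]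
  · have hsq : weightMul (cayleyMul (-1) f) = mulL2 (star invAddI * star invAddI) f := by
      rw [weightMul, cayleyMul, zpow_neg_one, ← mulL2_mul_apply, mul_comm invAddI, mul_assoc,
        invAddI_mul_cayley_inv]
    have hI : 2 * Complex.I * Complex.I = -2 := by linear_combination 2 * Complex.I_sq
    rw [hsq, HalfWave.cayleyMul_neg_one g, map_smul, smul_apply, smul_add, smul_smul, hI]
    module

theorem HasMomentum.cayleyMul {f g : L2} (h : HasMomentum f g) (n : ℤ) :
    HasMomentum (cayleyMul n f) (cayleyMul n g + (2 * n : ℂ) • weightMul (cayleyMul n f)) := by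
  induction n with
  | zero => simpa [cayleyMul_zero] using h
  | succ n ih =>
    rw [add_comm, cayleyMul_add]
    convert ih.cayleyMul_one using 1
    rw [cayleyMul_add, map_add, map_smul, ← weightMul_cayleyMul]
    push_cast
    module
  | pred n ih =>
    rw [sub_eq_add_neg, add_comm, cayleyMul_add]
    convert ih.cayleyMul_neg_one using 1
    rw [cayleyMul_add, map_add, map_smul, ← weightMul_cayleyMul]
    push_cast
    module

/-! ### The rational basis -/

/-- The function `(x - i) ^ n / (x + i) ^ (n + 1)`. These functions are orthogonal, and those with
`n ≥ 0` lie in the Hardy space of the upper half plane, those with `n < 0` in that of the lower. -/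
def ratBasis (n : ℤ) : L2 := cayleyMul n (isFourierPair_expKernel.memLp_right.toLp invAddI)

theorem ratBasis_zero : ratBasis 0 = isFourierPair_expKernel.memLp_right.toLp invAddI :=
  cayleyMul_zero _

theorem ratBasis_neg_one :
    ratBasis (-1) = isFourierPair_expKernel.star.memLp_right.toLp (⇑(star invAddI)) := by
  refine mulL2_toLp _ _ ?_
  rw [zpow_neg_one, mul_comm, invAddI_mul_cayley_inv]

theorem cayleyMul_ratBasis (a b : ℤ) : cayleyMul a (ratBasis b) = ratBasis (a + b) :=
  (cayleyMul_add a b _).symm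

theorem ratBasis_mem_hardy_one {n : ℤ} (hn : 0 ≤ n) : ratBasis n ∈ hardy 1 :=
  cayleyMul_mem_hardy_one hn
    (isFourierPair_expKernel.toLp_mem_hardy fun _ h => expKernel_of_neg (by linarith))

theorem ratBasis_mem_hardy_neg_one {n : ℤ} (hn : n < 0) : ratBasis n ∈ hardy (-1) := by
  have h : ratBasis n = cayleyMul (n + 1) (ratBasis (-1)) := by
    rw [cayleyMul_ratBasis, add_neg_cancel_right]
  rw [h, ratBasis_neg_one]
  exact cayleyMul_mem_hardy_neg_one hn (isFourierPair_expKernel.star.toLp_mem_hardy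
    fun _ h => by rw [expKernel_of_neg (by linarith), map_zero])

theorem inner_ratBasis_of_lt {j k : ℤ} (h : j < k) : inner ℂ (ratBasis j) (ratBasis k) = 0 := by
  have hj : ratBasis j = cayleyMul k (ratBasis (j - k)) := by
    rw [cayleyMul_ratBasis, add_sub_cancel]
  rw [hj, inner_cayleyMul_left, cayleyMul_ratBasis, neg_add_cancel]
  exact inner_eq_zero_of_hardy (ratBasis_mem_hardy_neg_one (by lia)) (ratBasis_mem_hardy_one le_rfl)

theorem inner_ratBasis_zero : inner ℂ (ratBasis 0) (ratBasis 0) = (Real.pi : ℂ) := by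
  rw [ratBasis_zero, L2.inner_def, ← integral_univ_inv_one_add_sq, ← integral_complex_ofReal]
  refine integral_congr_ae ?_
  filter_upwards [isFourierPair_expKernel.memLp_right.coeFn_toLp] with x h
  rw [h, RCLike.inner_apply, ← invAddI_mul_star_apply]
  rfl

theorem inner_ratBasis (j k : ℤ) :
    inner ℂ (ratBasis j) (ratBasis k) = if j = k then (Real.pi : ℂ) else 0 := by
  split_ifs with h
  · rw [← h, ratBasis, inner_cayleyMul_left, cayleyMul_neg_cayleyMul, ← ratBasis_zero,
      inner_ratBasis_zero]
  · rcases lt_or_gt_of_ne h with hlt | hgt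
    · exact inner_ratBasis_of_lt hlt
    · rw [← inner_conj_symm, inner_ratBasis_of_lt hgt, map_zero]

theorem weightMul_ratBasis (n : ℤ) :
    weightMul (ratBasis n) =
      (1 / 4 : ℂ) • ((2 : ℂ) • ratBasis n - ratBasis (n + 1) - ratBasis (n - 1)) := by
  rw [weightMul_eq, cayleyMul_ratBasis, cayleyMul_ratBasis, add_comm 1 n, neg_add_eq_sub]

theorem hasMomentum_ratBasis_zero :
    HasMomentum (ratBasis 0) ((1 / 2 : ℂ) • (ratBasis 0 - ratBasis 1)) := by
  have h := isFourierPair_expKernel.hasMomentum_toLp isFourierPair_mul_expKernel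
  rw [ratBasis_zero]
  convert h using 1
  rw [← mulL2_toLp isFourierPair_expKernel.memLp_right isFourierPair_mul_expKernel.memLp_right
    (smul_mul_assoc _ _ _), I_smul_invAddI, map_smul, map_sub, map_one, ratBasis, cayleyMul,
    zpow_one]
  rfl

theorem hasMomentum_ratBasis (n : ℤ) :
    HasMomentum (ratBasis n) ((1 / 2 : ℂ) • ((n + 1 : ℂ) • (ratBasis n - ratBasis (n + 1)) +
      (n : ℂ) • (ratBasis n - ratBasis (n - 1)))) := by
  have h := hasMomentum_ratBasis_zero.cayleyMul n
  rw [cayleyMul_ratBasis, add_zero, weightMul_ratBasis, map_smul, map_sub, cayleyMul_ratBasis,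
    cayleyMul_ratBasis, add_zero] at h
  convert h using 1
  module

theorem ratBasis_mem_H1 (n : ℤ) : ratBasis n ∈ H1 := (hasMomentum_ratBasis n).mem_H1

/-! ### The potential and the integral operator -/

theorem potentialOp_eq (m : ℕ) (f : L2) : potentialOp m f = (2 * m : ℂ) • weightMul f := by
  refine Lp.ext ?_
  filter_upwards [(memLp_potential_mul m f).coeFn_toLp, coeFn_mulL2 (invAddI * star invAddI) f,
    Lp.coeFn_smul (2 * m : ℂ) (weightMul f)] with x hpot hmul hsmul
  change ((memLp_potential_mul m f).toLp _ : L2) x = _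
  rw [hpot, hsmul, Pi.smul_apply, weightMul, hmul, invAddI_mul_star_apply, potential]
  push_cast
  simp only [smul_eq_mul]
  ring

theorem card_filter_range_sub_eq (m : ℕ) {d : ℤ} (hd : |d| ≤ m) :
    (((Finset.range m ×ˢ Finset.range m).filter fun p => (p.1 : ℤ) - p.2 = d).card : ℤ) =
      m - |d| := by
  rw [← Int.natCast_natAbs, Nat.cast_le] at hd
  rw [← Int.natCast_natAbs]
  have himage : (Finset.range m ×ˢ Finset.range m).filter (fun p => (p.1 : ℤ) - p.2 = d) =
      (Finset.range (m - d.natAbs)).image fun i => (i + d.toNat, i + (-d).toNat) := by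
    ext ⟨j, k⟩
    simp only [Finset.mem_filter, Finset.mem_product, Finset.mem_range, Finset.mem_image,
      Prod.mk.injEq]
    constructor
    · rintro ⟨⟨hj, hk⟩, hjk⟩
      exact ⟨j - d.toNat, by omega, by omega, by omega⟩
    · rintro ⟨i, hi, rfl, rfl⟩
      omega
  rw [himage, Finset.card_image_of_injective _ fun i j h => by simpa using h, Finset.card_range]
  omega

theorem sum_range_sum_range_sub {M : Type*} [AddCommGroup M] (m : ℕ) (g : ℤ → M) :
    ∑ j ∈ Finset.range m, ∑ k ∈ Finset.range m, g (j - k) =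
      ∑ d ∈ Finset.Icc (-m : ℤ) m, ((m : ℤ) - |d|) • g d := by
  have hmaps : ∀ p ∈ Finset.range m ×ˢ Finset.range m,
      (p.1 : ℤ) - p.2 ∈ Finset.Icc (-m : ℤ) m := by
    simp only [Finset.mem_product, Finset.mem_range, Finset.mem_Icc]
    omega
  rw [← Finset.sum_product', ← Finset.sum_fiberwise_of_maps_to hmaps]
  refine Finset.sum_congr rfl fun d hd => ?_
  rw [← card_filter_range_sub_eq m (abs_le.2 (Finset.mem_Icc.1 hd)), natCast_zsmul]
  exact Finset.sum_eq_card_nsmul fun p hp => by rw [(Finset.mem_filter.1 hp).2]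

theorem norm_geom_sum_sq (m : ℕ) {z : ℂ} (hz : ‖z‖ = 1) :
    ((‖∑ j ∈ Finset.range m, z ^ j‖ ^ 2 : ℝ) : ℂ) =
      ∑ d ∈ Finset.Icc (-m : ℤ) m, ((m : ℂ) - (|d| : ℤ)) * z ^ d := by
  have hz0 : z ≠ 0 := norm_ne_zero_iff.1 (by simp [hz])
  calc ((‖∑ j ∈ Finset.range m, z ^ j‖ ^ 2 : ℝ) : ℂ)
      = ∑ j ∈ Finset.range m, ∑ k ∈ Finset.range m, z ^ ((j : ℤ) - k) := by
        rw [Complex.ofReal_pow, ← Complex.mul_conj', map_sum, Finset.sum_mul_sum]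
        refine Finset.sum_congr rfl fun j _ => Finset.sum_congr rfl fun k _ => ?_
        rw [map_pow, ← Complex.inv_eq_conj hz, inv_pow, zpow_sub₀ hz0, zpow_natCast, zpow_natCast,
          div_eq_mul_inv]
    _ = _ := by
        rw [sum_range_sum_range_sub]
        simp only [zsmul_eq_mul]
        push_cast
        rfl

theorem norm_pow_sub_pow_sq (m : ℕ) {a b : ℂ} (ha : ‖a‖ = 1) (hb : ‖b‖ = 1) :
    ((‖a ^ m - b ^ m‖ ^ 2 : ℝ) : ℂ) = ((‖a - b‖ ^ 2 : ℝ) : ℂ) *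
      ∑ d ∈ Finset.Icc (-m : ℤ) m, ((m : ℂ) - (|d| : ℤ)) * (a ^ d * conj (b ^ d)) := by
  have hb0 : b ≠ 0 := norm_ne_zero_iff.1 (by simp [hb])
  have hfactor : a ^ m - b ^ m =
      b ^ m * (∑ j ∈ Finset.range m, (a / b) ^ j) * ((a - b) / b) := by
    rw [sub_div, div_self hb0, mul_assoc, geom_sum_mul, div_pow]
    field_simp
  have hnorm : ‖a ^ m - b ^ m‖ ^ 2 =
      ‖a - b‖ ^ 2 * ‖∑ j ∈ Finset.range m, (a / b) ^ j‖ ^ 2 := by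
    rw [hfactor, norm_mul, norm_mul, norm_pow, norm_div, hb]
    ring
  rw [hnorm, Complex.ofReal_mul, norm_geom_sum_sq m (by rw [norm_div, ha, hb, div_one])]
  refine congrArg _ (Finset.sum_congr rfl fun d _ => ?_)
  rw [div_zpow, map_zpow₀, ← Complex.inv_eq_conj hb, inv_zpow, div_eq_mul_inv]

/-- The function `((x - i) / (x + i)) ^ d / (1 + x²)`; these functions span the range of `R`. -/
def weightVec (d : ℤ) : L2 := mulL2 (star invAddI) (ratBasis d)

theorem weightVec_eq (d : ℤ) :
    weightVec d = (-(Complex.I / 2)) • (ratBasis (d - 1) - ratBasis d) := by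
  have h := cayleyMul_neg_one (ratBasis d)
  rw [cayleyMul_ratBasis, neg_add_eq_sub] at h
  have hI : -(Complex.I / 2) * (2 * Complex.I) = 1 := by linear_combination -Complex.I_sq
  rw [h, add_sub_cancel_left, smul_smul, weightVec, hI, one_smul]

theorem coeFn_weightVec (d : ℤ) : weightVec d =ᵐ[volume] fun x : ℝ =>
    (cayley : ℝ →ᵇ ℂ) x ^ d * (((1 + x ^ 2)⁻¹ : ℝ) : ℂ) := by
  have h := isFourierPair_expKernel.memLp_right
  filter_upwards [coeFn_mulL2 (star invAddI) (ratBasis d),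
    coeFn_mulL2 ((cayley ^ d : (ℝ →ᵇ ℂ)ˣ) : ℝ →ᵇ ℂ) (h.toLp invAddI), h.coeFn_toLp] with x h1 h2 h3
  rw [weightVec, h1, ratBasis, cayleyMul, h2, h3, cayley_zpow_apply, ← invAddI_mul_star_apply,
    BoundedContinuousFunction.mul_apply]
  ring

theorem inner_weightVec_ratBasis (d n : ℤ) :
    inner ℂ (weightVec d) (ratBasis n) =
      Complex.I * Real.pi / 2 * ((if d = n + 1 then 1 else 0) - if d = n then 1 else 0) := by
  rw [weightVec_eq, inner_smul_left, inner_sub_left, inner_ratBasis, inner_ratBasis]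
  simp only [sub_eq_iff_eq_add, map_neg, map_div₀, Complex.conj_I, map_ofNat]
  split_ifs <;> ring

/-- The coefficients of the rank one operators `|w_d⟩⟨w_d|`, `w_d = weightVec d`, in `R`. They are
those of the Fejér kernel of degree `m` up to a factor. -/
def fejerCoeff (m : ℕ) (d : ℤ) : ℝ := 2 / Real.pi * (m - (|d| : ℤ))

theorem fejerCoeff_nonneg {m : ℕ} {d : ℤ} (hd : d ∈ Finset.Icc (-m : ℤ) m) :
    0 ≤ fejerCoeff m d := by
  have habs : ((|d| : ℤ) : ℝ) ≤ m := by exact_mod_cast abs_le.2 (Finset.mem_Icc.1 hd)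
  exact mul_nonneg (by positivity) (sub_nonneg.2 habs)

theorem kernelR_eq_sum (m : ℕ) {x y : ℝ} (hxy : x ≠ y) :
    (kernelR m x y : ℂ) = ∑ d ∈ Finset.Icc (-m : ℤ) m, (fejerCoeff m d : ℂ) *
      ((cayley : ℝ →ᵇ ℂ) x ^ d * (((1 + x ^ 2)⁻¹ : ℝ) : ℂ) *
        conj ((cayley : ℝ →ᵇ ℂ) y ^ d * (((1 + y ^ 2)⁻¹ : ℝ) : ℂ))) := by
  have hpow : ‖(Complex.I * (cayley : ℝ →ᵇ ℂ) x) ^ m - (Complex.I * (cayley : ℝ →ᵇ ℂ) y) ^ m‖ =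
      ‖(cayley : ℝ →ᵇ ℂ) x ^ m - (cayley : ℝ →ᵇ ℂ) y ^ m‖ := by
    rw [mul_pow, mul_pow, ← mul_sub, norm_mul, norm_pow, Complex.norm_I, one_pow, one_mul]
  have hsub := norm_cayley_sub_sq x y
  rw [← cayley_apply, ← cayley_apply, ← mul_sub, norm_mul, Complex.norm_I, one_mul] at hsub
  have hd : ((|x - y| : ℝ) : ℂ) ≠ 0 :=
    Complex.ofReal_ne_zero.2 (abs_ne_zero.2 (sub_ne_zero.mpr hxy))
  have hπ : (Real.pi : ℂ) ≠ 0 := Complex.ofReal_ne_zero.2 Real.pi_ne_zero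
  rw [kernelR_eq, ← cayley_apply, ← cayley_apply, hpow, Complex.ofReal_mul,
    Complex.ofReal_div (_ ^ 2), norm_pow_sub_pow_sq m (norm_cayley_apply x) (norm_cayley_apply y),
    hsub, Finset.mul_sum, Finset.sum_div, Finset.mul_sum]
  refine Finset.sum_congr rfl fun d _ => ?_
  rw [fejerCoeff, map_mul, Complex.conj_ofReal]
  generalize (1 + x ^ 2)⁻¹ = X
  generalize (1 + y ^ 2)⁻¹ = Y
  generalize |d| = k
  push_cast
  field_simp
  ring

theorem opR_eq_sum (m : ℕ) (f : L2) :
    opR m f = ∑ d ∈ Finset.Icc (-m : ℤ) m,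
      ((fejerCoeff m d : ℂ) * inner ℂ (weightVec d) f) • weightVec d := by
  have hw : ∀ᵐ x : ℝ, ∀ d : ℤ, weightVec d x = _ := ae_all_iff.2 coeFn_weightVec
  have hsmul : ∀ᵐ x : ℝ, ∀ d : ℤ,
      (((fejerCoeff m d : ℂ) * inner ℂ (weightVec d) f) • weightVec d : L2) x = _ :=
    ae_all_iff.2 fun d => Lp.coeFn_smul _ (weightVec d)
  refine Lp.ext ?_
  filter_upwards [(memLp_kernelR m f).coeFn_toLp, hw, hsmul,
    Lp.coeFn_finsetSum (Finset.Icc (-m : ℤ) m) fun d =>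
      (((fejerCoeff m d : ℂ) * inner ℂ (weightVec d) f) • weightVec d : L2)] with x hR hwx hsx hsum
  have hint (d : ℤ) : Integrable fun y => conj (weightVec d y) * f y :=
    (Lp.memLp (weightVec d)).star.integrable_mul (Lp.memLp f)
  have hne : ∀ᵐ y : ℝ, y ≠ x := by simp [ae_iff]
  calc opR m f x = ∫ y, (kernelR m x y : ℂ) * f y := hR
    _ = ∫ y, ∑ d ∈ Finset.Icc (-m : ℤ) m,
        ((fejerCoeff m d : ℂ) * weightVec d x) * (conj (weightVec d y) * f y) := by
        refine integral_congr_ae ?_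
        filter_upwards [hw, hne] with y hwy hy
        rw [kernelR_eq_sum m hy.symm, Finset.sum_mul]
        simp only [hwx, hwy, mul_assoc]
    _ = ∑ d ∈ Finset.Icc (-m : ℤ) m,
        (fejerCoeff m d : ℂ) * inner ℂ (weightVec d) f * weightVec d x := by
        rw [integral_finsetSum _ fun d _ => (hint d).const_mul _]
        refine Finset.sum_congr rfl fun d _ => ?_
        rw [integral_const_mul, L2.inner_def, mul_right_comm]
        simp only [RCLike.inner_apply, mul_comm]
    _ = _ := by
        rw [hsum, Finset.sum_apply]
        exact Finset.sum_congr rfl fun d _ => (hsx d).symm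

theorem inner_opR (m : ℕ) (f g : L2) :
    inner ℂ f (opR m g) = ∑ d ∈ Finset.Icc (-m : ℤ) m,
      (fejerCoeff m d : ℂ) * (inner ℂ f (weightVec d) * inner ℂ (weightVec d) g) := by
  rw [opR_eq_sum, inner_sum]
  refine Finset.sum_congr rfl fun d _ => ?_
  rw [inner_smul_right]
  ring

theorem opR_symmetric (m : ℕ) (f g : L2) : inner ℂ (opR m f) g = inner ℂ f (opR m g) := by
  rw [← inner_conj_symm, inner_opR, inner_opR, map_sum]
  refine Finset.sum_congr rfl fun d _ => ?_
  rw [map_mul, map_mul, Complex.conj_ofReal, inner_conj_symm, inner_conj_symm,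
    mul_comm (inner ℂ _ g)]

theorem opR_eq_zero_of_forall_inner (m : ℕ) {f : L2}
    (h : ∀ n : ℤ, -m ≤ n → n < m → inner ℂ (ratBasis n) f = 0) : opR m f = 0 := by
  rw [opR_eq_sum]
  refine Finset.sum_eq_zero fun d hd => ?_
  rcases (abs_le.2 (Finset.mem_Icc.1 hd)).eq_or_lt with hm | hm
  · simp [fejerCoeff, hm]
  · obtain ⟨hlo, hhi⟩ := abs_lt.1 hm
    rw [weightVec_eq, inner_smul_left, inner_sub_left, h _ (by lia) (by lia), h _ (by lia) hhi,
      sub_zero, mul_zero, mul_zero, zero_smul]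

theorem opR_ratBasis (m : ℕ) {n : ℤ} (hlo : -m ≤ n) (hhi : n < m) :
    opR m (ratBasis n) = (1 / 2 : ℂ) •
      (((m : ℂ) - (|n| : ℤ)) • (ratBasis n - ratBasis (n - 1)) -
        ((m : ℂ) - (|n + 1| : ℤ)) • (ratBasis (n + 1) - ratBasis n)) := by
  have hcoeff (d : ℤ) : (fejerCoeff m d : ℂ) * inner ℂ (weightVec d) (ratBasis n) =
      (if d = n + 1 then Complex.I * (m - (|d| : ℤ)) else 0) -
        if d = n then Complex.I * (m - (|d| : ℤ)) else 0 := by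
    have hπ : (Real.pi : ℂ) ≠ 0 := Complex.ofReal_ne_zero.2 Real.pi_ne_zero
    rw [inner_weightVec_ratBasis, fejerCoeff, Complex.ofReal_mul, Complex.ofReal_div,
      Complex.ofReal_sub, Complex.ofReal_intCast, Complex.ofReal_natCast, Complex.ofReal_ofNat]
    field_simp
    split_ifs <;> ring
  have hI (a : ℂ) : Complex.I * a * -(Complex.I / 2) = 1 / 2 * a := by
    linear_combination (-a / 2) * Complex.I_sq
  rw [opR_eq_sum]
  simp only [hcoeff, sub_smul, ite_smul, zero_smul, Finset.sum_sub_distrib]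
  rw [Finset.sum_ite_eq', Finset.sum_ite_eq', if_pos (Finset.mem_Icc.2 ⟨by lia, by lia⟩),
    if_pos (Finset.mem_Icc.2 ⟨hlo, hhi.le⟩), weightVec_eq, weightVec_eq, smul_smul, smul_smul, hI,
    hI, add_sub_cancel_right]
  module

/-! ### The operators on the rational basis -/

/-- `L₊` as a linear map on `H¹(ℝ)`. -/
def lplus (m : ℕ) : H1 →ₗ[ℂ] L2 := (Lplus m).toFun

/-- `L₋` as a linear map on `H¹(ℝ)`. -/
def lminus (m : ℕ) : H1 →ₗ[ℂ] L2 := (Lminus m).toFun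

theorem lplus_apply (m : ℕ) (u : H1) :
    lplus m u = absNabla u - (2 * m : ℂ) • weightMul (u : L2) := by
  rw [← potentialOp_eq]
  rfl

theorem lminus_apply (m : ℕ) (u : H1) : lminus m u = lplus m u + opR m (u : L2) := rfl

-- The momentum of a power of the Cayley transform cancels the potential.
theorem lplus_cayleyMul (m : ℕ) {f g : L2} (h : HasMomentum f g) (hf : f ∈ hardy 1)
    {u : H1} (hu : (u : L2) = cayleyMul m f) : lplus m u = cayleyMul m g := by
  have hmom := h.cayleyMul m
  rw [← hu] at hmom
  have hmem : (u : L2) ∈ hardy 1 := hu ▸ cayleyMul_mem_hardy_one (by positivity) hf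
  rw [lplus_apply, absNabla_of_hardy (by norm_num) hmom hmem]
  push_cast
  module

theorem lplus_cayleyMul_neg (m : ℕ) {f g : L2} (h : HasMomentum f g) (hf : f ∈ hardy (-1))
    {u : H1} (hu : (u : L2) = cayleyMul (-m) f) : lplus m u = -cayleyMul (-m) g := by
  have hmom := h.cayleyMul (-m)
  rw [← hu] at hmom
  have hmem : (u : L2) ∈ hardy (-1) := hu ▸ cayleyMul_mem_hardy_neg_one (by simp) hf
  rw [lplus_apply, absNabla_of_hardy (by norm_num) hmom hmem]
  push_cast
  module

theorem lplus_ratBasis (m : ℕ) (n : ℤ) :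
    lplus m ⟨ratBasis n, ratBasis_mem_H1 n⟩ = (1 / 2 : ℂ) •
      (((m : ℂ) - (|n + 1| : ℤ)) • (ratBasis (n + 1) - ratBasis n) -
        ((m : ℂ) - (|n| : ℤ)) • (ratBasis n - ratBasis (n - 1))) := by
  rw [lplus_apply]
  simp only [weightMul_ratBasis]
  rcases le_or_gt 0 n with hn | hn
  · rw [absNabla_of_hardy (f := ⟨ratBasis n, ratBasis_mem_H1 n⟩) (σ := 1) (by norm_num)
      (hasMomentum_ratBasis n) (ratBasis_mem_hardy_one hn), abs_of_nonneg hn,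
      abs_of_nonneg (by lia)]
    push_cast
    module
  · rw [absNabla_of_hardy (f := ⟨ratBasis n, ratBasis_mem_H1 n⟩) (σ := -1) (by norm_num)
      (hasMomentum_ratBasis n) (ratBasis_mem_hardy_neg_one hn), abs_of_neg hn,
      abs_of_nonpos (by lia)]
    push_cast
    module

theorem lminus_ratBasis (m : ℕ) {n : ℤ} (hlo : -m ≤ n) (hhi : n < m) :
    lminus m ⟨ratBasis n, ratBasis_mem_H1 n⟩ = 0 := by
  rw [lminus_apply, lplus_ratBasis, opR_ratBasis m hlo hhi]
  module

theorem lplus_symmetric (m : ℕ) (u v : H1) :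
    inner ℂ (lplus m u) (v : L2) = inner ℂ (u : L2) (lplus m v) := by
  have hstar : star (invAddI * star invAddI) = invAddI * star invAddI := by
    rw [star_mul, star_star]
  rw [lplus_apply, lplus_apply, inner_sub_left, inner_sub_right, absNabla_symmetric,
    inner_smul_left, inner_smul_right, weightMul, inner_mulL2_left, hstar]
  simp [map_ofNat]

theorem lminus_symmetric (m : ℕ) (u v : H1) :
    inner ℂ (lminus m u) (v : L2) = inner ℂ (u : L2) (lminus m v) := by
  rw [lminus_apply, lminus_apply, inner_add_left, inner_add_right, lplus_symmetric, opR_symmetric]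

/-! ### The model space of the Cayley transform -/

theorem expKernel_sub {ξ η : ℝ} (hξ : ξ < 0) (hη : 0 < η) :
    conj (expKernel (-(ξ - η))) = Real.exp (2 * Real.pi * ξ) * conj (expKernel η) := by
  have hexp : Complex.exp (-(2 * Real.pi * (η - ξ))) =
      Complex.exp (2 * Real.pi * ξ) * Complex.exp (-(2 * Real.pi * η)) := by
    rw [← Complex.exp_add]
    ring_nf
  simp [expKernel, gammaKernel, hη, hξ.trans hη, ← Complex.exp_conj, hexp, map_ofNat]
  ring

-- On the negative half line the transform of `g / (x - i)` is `exp (2πξ) ⟪ratBasis 0, g⟫`.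
theorem mulL2_star_invAddI_mem_hardy_one {g : L2} (hg : g ∈ hardy 1)
    (h0 : inner ℂ (ratBasis 0) g = 0) : mulL2 (star invAddI) g ∈ hardy 1 := by
  have hbasis : ((𝓕 (ratBasis 0) : L2) : ℝ → ℂ) =ᵐ[volume] expKernel := by
    rw [ratBasis_zero, isFourierPair_expKernel.fourier_toLp]
    exact isFourierPair_expKernel.memLp.coeFn_toLp
  have hne : ∀ᵐ η : ℝ, η ≠ 0 := by simp [ae_iff]
  filter_upwards [isFourierPair_expKernel.star.fourier_mulL2 g] with ξ hξ hneg
  calc (𝓕 (mulL2 (star invAddI) g) : L2) ξ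
      = ∫ η, conj (expKernel (-(ξ - η))) * (𝓕 g : L2) η := hξ
    _ = ∫ η, (Real.exp (2 * Real.pi * ξ) : ℂ) *
          ((𝓕 g : L2) η * conj ((𝓕 (ratBasis 0) : L2) η)) := by
        refine integral_congr_ae ?_
        filter_upwards [hg, hne, hbasis] with η h1 h2 h3
        rcases lt_or_gt_of_ne h2 with h | h
        · simp [h1 (by linarith)]
        · rw [h3, expKernel_sub (by linarith) h]
          ring
    _ = 0 := by rw [integral_const_mul, ← inner_eq_integral_fourier, h0, mul_zero]

theorem cayleyMul_neg_one_mem_hardy_one {g : L2} (hg : g ∈ hardy 1)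
    (h0 : inner ℂ (ratBasis 0) g = 0) : cayleyMul (-1) g ∈ hardy 1 := by
  rw [cayleyMul_neg_one]
  exact add_mem hg (Submodule.smul_mem _ _ (mulL2_star_invAddI_mem_hardy_one hg h0))

theorem exists_eq_smul_add_cayleyMul {h : L2} (hh : h ∈ hardy 1) :
    ∃ c : ℂ, ∃ g ∈ hardy 1, h = c • ratBasis 0 + cayleyMul 1 g := by
  have hπ : (Real.pi : ℂ) ≠ 0 := Complex.ofReal_ne_zero.2 Real.pi_ne_zero
  refine ⟨inner ℂ (ratBasis 0) h / Real.pi,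
    cayleyMul (-1) (h - (inner ℂ (ratBasis 0) h / Real.pi : ℂ) • ratBasis 0),
    cayleyMul_neg_one_mem_hardy_one
      (sub_mem hh (Submodule.smul_mem _ _ (ratBasis_mem_hardy_one le_rfl))) ?_, ?_⟩
  · rw [inner_sub_right, inner_smul_right, inner_ratBasis_zero, div_mul_cancel₀ _ hπ, sub_self]
  · rw [cayleyMul_cayleyMul_neg]
    abel

theorem cayleyMul_mem_span_ratBasis (k : ℤ) {s t : Set ℤ} (hst : ∀ n ∈ s, k + n ∈ t) {h : L2}
    (hh : h ∈ Submodule.span ℂ (ratBasis '' s)) :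
    cayleyMul k h ∈ Submodule.span ℂ (ratBasis '' t) := by
  have hmap := Submodule.mem_map_of_mem (f := (cayleyMul k : L2 →ₗ[ℂ] L2)) hh
  rw [Submodule.map_span] at hmap
  refine Submodule.span_mono ?_ hmap
  rintro _ ⟨_, ⟨n, hn, rfl⟩, rfl⟩
  exact ⟨k + n, hst n hn, (cayleyMul_ratBasis k n).symm⟩

theorem mem_span_ratBasis_of_hardy (k : ℕ) {h : L2} (h₁ : h ∈ hardy 1)
    (h₂ : cayleyMul (-k) h ∈ hardy (-1)) :
    h ∈ Submodule.span ℂ (ratBasis '' Set.Ico 0 (k : ℤ)) := by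
  induction k generalizing h with
  | zero =>
    rw [Nat.cast_zero, neg_zero, cayleyMul_zero] at h₂
    rw [eq_zero_of_hardy h₂ h₁]
    exact zero_mem _
  | succ k ih =>
    obtain ⟨c, g, hg, rfl⟩ := exists_eq_smul_add_cayleyMul h₁
    have hshift : cayleyMul (-((k + 1 : ℕ) : ℤ)) (c • ratBasis 0 + cayleyMul 1 g) =
        c • ratBasis (-((k + 1 : ℕ) : ℤ)) + cayleyMul (-k) g := by
      rw [map_add, map_smul, cayleyMul_ratBasis, ← cayleyMul_add, add_zero]
      congr 3
      lia
    have hg' : cayleyMul (-k) g ∈ hardy (-1) := by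
      rw [hshift] at h₂
      simpa only [add_sub_cancel_left] using sub_mem h₂ (Submodule.smul_mem _ c
        (ratBasis_mem_hardy_neg_one (n := -((k + 1 : ℕ) : ℤ)) (by lia)))
    refine add_mem (Submodule.smul_mem _ _ (Submodule.subset_span ⟨0, by simp, rfl⟩)) ?_
    exact cayleyMul_mem_span_ratBasis 1 (fun n hn => by simp at hn ⊢; lia) (ih hg hg')

/-- The span of the functions `ratBasis n` with `-m ≤ n < m`, which contains all eigenfunctions of
`L₊` and `L₋`. -/
def ratSpan (m : ℕ) : Submodule ℂ L2 :=
  Submodule.span ℂ (ratBasis '' Set.Ico (-(m : ℤ)) m)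

theorem mem_ratSpan_of_hardy (m : ℕ) {f : L2} (h₁ : cayleyMul m f ∈ hardy 1)
    (h₂ : cayleyMul (-m) f ∈ hardy (-1)) : f ∈ ratSpan m := by
  have h₂' : cayleyMul (-((2 * m : ℕ) : ℤ)) (cayleyMul m f) ∈ hardy (-1) := by
    rw [← cayleyMul_add]
    convert h₂ using 3
    lia
  have h := cayleyMul_mem_span_ratBasis (-m) (t := Set.Ico (-(m : ℤ)) m)
    (fun n hn => by simp at hn ⊢; lia) (mem_span_ratBasis_of_hardy (2 * m) h₁ h₂')
  rwa [cayleyMul_neg_cayleyMul] at h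

/-! ### Eigenfunctions -/

theorem exists_fourier_ae_eq_indicator (g : L2) {S : Set ℝ} (hS : MeasurableSet S) :
    ∃ f : L2, ((𝓕 f : L2) : ℝ → ℂ) =ᵐ[volume] S.indicator (𝓕 g : L2) := by
  refine ⟨𝓕⁻ (((Lp.memLp (𝓕 g : L2)).indicator hS).toLp _), ?_⟩
  rw [fourier_fourierInv_eq]
  exact MemLp.coeFn_toLp _

theorem exists_hasMomentum_fourier_ae_eq_indicator (g : L2) (z : ℂ) {S : Set ℝ}
    (hS : MeasurableSet S) {N : ℝ} (hN : ∀ ξ ∈ S, |ξ| ≤ N) :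
    ∃ f f' : L2, HasMomentum f f' ∧ ((𝓕 f : L2) : ℝ → ℂ) =ᵐ[volume]
      S.indicator fun ξ => ((2 * Real.pi * ξ : ℝ) - z) * (𝓕 g : L2) ξ := by
  obtain ⟨f, hf⟩ := exists_fourier_ae_eq_indicator g hS
  have hfS : ∀ᵐ ξ, N < |ξ| → (𝓕 f : L2) ξ = 0 := by
    filter_upwards [hf] with ξ hξ hlt
    rw [hξ, Set.indicator_of_notMem fun hmem => hlt.not_ge (hN ξ hmem)]
  obtain ⟨f₁, hf₁⟩ := exists_hasMomentum_of_ae_eq_zero hfS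
  have hF : ((𝓕 (f₁ + -z • f) : L2) : ℝ → ℂ) =ᵐ[volume]
      fun ξ => ((2 * Real.pi * ξ : ℝ) - z) * (𝓕 f : L2) ξ := by
    filter_upwards [hf₁, coeFn_fourier_add f₁ (-z • f), coeFn_fourier_smul (-z) f] with ξ h1 h2 h3
    rw [h2, h3, h1]
    ring
  have hFS : ∀ᵐ ξ, N < |ξ| → (𝓕 (f₁ + -z • f) : L2) ξ = 0 := by
    filter_upwards [hF, hfS] with ξ h1 h2 h
    rw [h1, h2 h, mul_zero]
  obtain ⟨f₂, hf₂⟩ := exists_hasMomentum_of_ae_eq_zero hFS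
  refine ⟨_, f₂, hf₂, ?_⟩
  filter_upwards [hF, hf] with ξ h1 h2
  rw [h1, h2, Set.indicator_mul_right]

-- Testing with `f` whose transform is `(2πξ - z) 𝓕 g` cut off to `S` gives `‖f‖² = 0`.
theorem ae_eq_zero_of_forall_inner {g : L2} {z : ℂ} {S : Set ℝ} (hS : MeasurableSet S) {N : ℝ}
    (hN : ∀ ξ ∈ S, |ξ| ≤ N)
    (h : ∀ f f' : L2, (∀ᵐ ξ, ξ ∉ S → (𝓕 f : L2) ξ = 0) → HasMomentum f f' →
      inner ℂ f' g = z * inner ℂ f g) :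
    ∀ᵐ ξ, ξ ∈ S → (𝓕 g : L2) ξ = 0 := by
  obtain ⟨f, f', hmom, hf⟩ := exists_hasMomentum_fourier_ae_eq_indicator g z hS hN
  have hnorm : inner ℂ f' g - z * inner ℂ f g = inner ℂ f f := by
    have hint (u : L2) : Integrable fun ξ => (𝓕 g : L2) ξ * conj ((𝓕 u : L2) ξ) :=
      (Lp.memLp (𝓕 g : L2)).integrable_mul (Lp.memLp (𝓕 u : L2)).star
    rw [inner_eq_integral_fourier, inner_eq_integral_fourier, inner_eq_integral_fourier,
      ← integral_const_mul, ← integral_sub (hint f') ((hint f).const_mul z)]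
    refine integral_congr_ae ?_
    filter_upwards [hmom, hf] with ξ h1 h2
    rw [h1, h2]
    by_cases hξ : ξ ∈ S
    · rw [Set.indicator_of_mem hξ, map_mul, Complex.conj_ofReal]
      ring
    · simp [hξ]
  have hf0 : f = 0 := by
    rw [← inner_self_eq_zero (𝕜 := ℂ), ← hnorm, h f f' ?_ hmom, sub_self]
    filter_upwards [hf] with ξ h1 hξ
    rw [h1, Set.indicator_of_notMem hξ]
  have hne : ∀ᵐ ξ : ℝ, ξ ≠ z.re / (2 * Real.pi) := by simp [ae_iff]
  filter_upwards [hf, coeFn_fourier_smul 0 f, hne] with ξ h1 h2 h3 hξ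
  rw [zero_smul, ← hf0, h1, Set.indicator_of_mem hξ, zero_mul] at h2
  refine (mul_eq_zero.1 h2).resolve_left fun h4 => h3 ?_
  rw [← sub_eq_zero.1 h4, Complex.ofReal_re, mul_div_cancel_left₀ _ (by positivity)]

theorem mem_hardy_of_forall_inner {σ : ℝ} {g : L2} {z : ℂ}
    (h : ∀ f f' : L2, f ∈ hardy σ → HasMomentum f f' → inner ℂ f' g = z * inner ℂ f g) :
    g ∈ hardy (-σ) := by
  have hcut (N : ℕ) : ∀ᵐ ξ : ℝ, ξ ∈ {ξ | 0 < σ * ξ ∧ |ξ| ≤ N} → (𝓕 g : L2) ξ = 0 := by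
    refine ae_eq_zero_of_forall_inner ?_ (fun ξ hξ => hξ.2) fun f f' hf hmom => h f f' ?_ hmom
    · exact (measurableSet_lt measurable_const (measurable_const_mul σ)).inter
        (measurableSet_le continuous_abs.measurable measurable_const)
    · filter_upwards [hf] with ξ h1 h2
      exact h1 fun h3 => lt_asymm h2 h3.1
  filter_upwards [ae_all_iff.2 hcut] with ξ hξ hneg
  obtain ⟨N, hN⟩ := exists_nat_ge |ξ|
  exact hξ N ⟨by linarith, hN⟩

theorem mem_ratSpan_of_eigenvector {m : ℕ} {A : H1 →ₗ[ℂ] L2}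
    (hA : ∀ u v : H1, inner ℂ (A u) (v : L2) = inner ℂ (u : L2) (A v))
    (hpos : ∀ (f g : L2) (u : H1), HasMomentum f g → f ∈ hardy 1 → (u : L2) = cayleyMul m f →
      A u = cayleyMul m g)
    (hneg : ∀ (f g : L2) (u : H1), HasMomentum f g → f ∈ hardy (-1) →
      (u : L2) = cayleyMul (-m) f → A u = -cayleyMul (-m) g)
    {u : H1} {z : ℂ} (hu : A u = z • (u : L2)) : (u : L2) ∈ ratSpan m := by
  apply mem_ratSpan_of_hardy
  · rw [← neg_neg (1 : ℝ)]
    refine mem_hardy_of_forall_inner (z := -z) fun f g hf hfg => ?_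
    have h := hA ⟨cayleyMul (-m) f, (hfg.cayleyMul (-m)).mem_H1⟩ u
    rw [hneg f g _ hfg hf rfl, hu, inner_neg_left, inner_smul_right, inner_cayleyMul_left,
      inner_cayleyMul_left, neg_neg] at h
    linear_combination -h
  · refine mem_hardy_of_forall_inner (z := z) fun f g hf hfg => ?_
    have h := hA ⟨cayleyMul m f, (hfg.cayleyMul m).mem_H1⟩ u
    rwa [hpos f g _ hfg hf rfl, hu, inner_smul_right, inner_cayleyMul_left,
      inner_cayleyMul_left] at h

theorem mem_ratSpan_of_lplus_eq {m : ℕ} {u : H1} {z : ℂ} (hu : lplus m u = z • (u : L2)) :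
    (u : L2) ∈ ratSpan m :=
  mem_ratSpan_of_eigenvector (lplus_symmetric m)
    (fun _ _ _ hfg hf h => lplus_cayleyMul m hfg hf h)
    (fun _ _ _ hfg hf h => lplus_cayleyMul_neg m hfg hf h) hu

theorem inner_ratBasis_cayleyMul (n k : ℤ) (f : L2) :
    inner ℂ (ratBasis n) (cayleyMul k f) = inner ℂ (ratBasis (n - k)) f := by
  rw [← cayleyMul_cayleyMul_neg k (ratBasis n), inner_cayleyMul_left, cayleyMul_neg_cayleyMul,
    cayleyMul_ratBasis, neg_add_eq_sub]

theorem opR_cayleyMul (m : ℕ) {f : L2} (hf : f ∈ hardy 1) : opR m (cayleyMul m f) = 0 := by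
  refine opR_eq_zero_of_forall_inner m fun n _ hn => ?_
  rw [inner_ratBasis_cayleyMul]
  exact inner_eq_zero_of_hardy (ratBasis_mem_hardy_neg_one (by lia)) hf

theorem opR_cayleyMul_neg (m : ℕ) {f : L2} (hf : f ∈ hardy (-1)) :
    opR m (cayleyMul (-m) f) = 0 := by
  refine opR_eq_zero_of_forall_inner m fun n hn _ => ?_
  rw [inner_ratBasis_cayleyMul, ← inner_conj_symm,
    inner_eq_zero_of_hardy hf (ratBasis_mem_hardy_one (by lia)), map_zero]

theorem mem_ratSpan_of_lminus_eq {m : ℕ} {u : H1} {z : ℂ} (hu : lminus m u = z • (u : L2)) :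
    (u : L2) ∈ ratSpan m :=
  mem_ratSpan_of_eigenvector (lminus_symmetric m)
    (fun _ _ _ hfg hf h => by
      rw [lminus_apply, lplus_cayleyMul m hfg hf h, h, opR_cayleyMul m hf, add_zero])
    (fun _ _ _ hfg hf h => by
      rw [lminus_apply, lplus_cayleyMul_neg m hfg hf h, h, opR_cayleyMul_neg m hf, add_zero]) hu

/-! ### The point spectrum -/

section ReductionToSubspace

variable {H : Type*} [NormedAddCommGroup H] [InnerProductSpace ℂ H] {T : H →ₗ.[ℂ] H} {z : ℂ}

theorem mem_eigenspace_iff {u : T.domain} : u ∈ eigenspace T z ↔ T u = z • (u : H) :=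
  sub_eq_zero

theorem mem_pointSpectrum_iff_eigenspace_ne_bot : z ∈ pointSpectrum T ↔ eigenspace T z ≠ ⊥ := by
  simp only [Submodule.ne_bot_iff, mem_eigenspace_iff, and_comm]
  rfl

variable {V : Submodule ℂ H} {A : V →ₗ[ℂ] V} (hA : ∀ v : V, ∃ u : T.domain, (u : H) = v ∧ T u = A v)
  (hV : ∀ (u : T.domain) (z : ℂ), T u = z • (u : H) → (u : H) ∈ V)

include hA hV

theorem map_eigenspace_eq_map_eigenspace :
    (eigenspace T z).map T.domain.subtype = (Module.End.eigenspace A z).map V.subtype := by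
  refine le_antisymm ?_ ?_
  · rintro _ ⟨u, hu, rfl⟩
    have hTu := mem_eigenspace_iff.1 hu
    obtain ⟨u', huu', hTu'⟩ := hA ⟨u, hV u z hTu⟩
    obtain rfl : u' = u := Subtype.ext huu'
    exact ⟨⟨u', hV u' z hTu⟩,
      Module.End.mem_eigenspace_iff.2 (Subtype.ext (hTu'.symm.trans hTu)), rfl⟩
  · rintro _ ⟨v, hv, rfl⟩
    obtain ⟨u, huv, hTu⟩ := hA v
    refine ⟨u, mem_eigenspace_iff.2 ?_, huv⟩
    rw [hTu, Module.End.mem_eigenspace_iff.1 hv, huv]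
    rfl

theorem finrank_eigenspace_eq_finrank_eigenspace :
    Module.finrank ℂ (eigenspace T z) = Module.finrank ℂ (Module.End.eigenspace A z) := by
  rw [(Submodule.equivMapOfInjective _ T.domain.injective_subtype _).finrank_eq,
    map_eigenspace_eq_map_eigenspace hA hV]
  exact (Submodule.equivMapOfInjective _ V.injective_subtype _).finrank_eq.symm

theorem mem_pointSpectrum_iff_hasEigenvalue :
    z ∈ pointSpectrum T ↔ Module.End.HasEigenvalue A z := by
  rw [mem_pointSpectrum_iff_eigenspace_ne_bot, Module.End.hasEigenvalue_iff, ne_eq, ne_eq,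
    ← (Submodule.map_injective_of_injective T.domain.injective_subtype).eq_iff, Submodule.map_bot,
    map_eigenspace_eq_map_eigenspace hA hV, ← Submodule.map_bot V.subtype,
    (Submodule.map_injective_of_injective V.injective_subtype).eq_iff]

end ReductionToSubspace

theorem exists_strictMono_eigenvalues {𝕜 V : Type*} [RCLike 𝕜] [NormedAddCommGroup V]
    [InnerProductSpace 𝕜 V] [FiniteDimensional 𝕜 V] {T : V →ₗ[𝕜] V} (hT : T.IsSymmetric) {n : ℕ}
    (hn : Module.finrank 𝕜 V = n)
    (hsimple : ∀ μ : 𝕜, Module.finrank 𝕜 (Module.End.eigenspace T μ) ≤ 1) :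
    ∃ E : Fin n → ℝ, StrictMono E ∧
      {μ | Module.End.HasEigenvalue T μ} = Set.range fun k => (E k : 𝕜) := by
  have hanti := hT.eigenvalues_antitone hn
  have hinj : Function.Injective (hT.eigenvalues hn) := fun i j hij => by
    have hcard := (hT.card_filter_eigenvalues_eq hn (hT.eigenvalues hn i : 𝕜)).trans_le (hsimple _)
    exact Finset.card_le_one.1 hcard i (by simp) j (by simp [hij])
  refine ⟨fun k => hT.eigenvalues hn k.rev,
    fun i j hij => (hanti.strictAnti_of_injective hinj) (Fin.rev_lt_rev.2 hij), ?_⟩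
  ext μ
  constructor
  · intro h
    obtain ⟨i, hi⟩ := hT.exists_eigenvalues_eq hn h
    exact ⟨i.rev, by simpa only [Fin.rev_rev] using hi⟩
  · rintro ⟨k, rfl⟩
    exact hT.hasEigenvalue_eigenvalues hn k.rev

theorem linearIndependent_ratBasis : LinearIndependent ℂ ratBasis := by
  refine linearIndependent_of_ne_zero_of_inner_eq_zero (fun n h => ?_) fun i j hij =>
    (inner_ratBasis i j).trans (if_neg hij)
  have hnn := inner_ratBasis n n
  rw [h, inner_zero_left, if_pos rfl] at hnn
  exact Real.pi_ne_zero (Complex.ofReal_eq_zero.1 hnn.symm)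

theorem finrank_ratSpan (m : ℕ) : Module.finrank ℂ (ratSpan m) = 2 * m := by
  have h := finrank_span_eq_card (R := ℂ) (linearIndependent_ratBasis.comp
    (Subtype.val : Set.Ico (-(m : ℤ)) m → ℤ) Subtype.val_injective)
  rw [Set.range_comp, Subtype.range_coe] at h
  rw [ratSpan, h, ← Set.toFinset_card, Set.toFinset_Ico, Int.card_Ico]
  lia

instance finiteDimensional_ratSpan (m : ℕ) : FiniteDimensional ℂ (ratSpan m) :=
  FiniteDimensional.span_of_finite ℂ ((Set.finite_Ico _ _).image _)

theorem ratBasis_mem_ratSpan {m : ℕ} {n : ℤ} (hlo : -m ≤ n) (hhi : n < m) :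
    ratBasis n ∈ ratSpan m := Submodule.subset_span ⟨n, ⟨hlo, hhi⟩, rfl⟩

theorem ratSpan_le_map_ker_lminus (m : ℕ) :
    ratSpan m ≤ (LinearMap.ker (lminus m)).map H1.subtype := by
  rw [ratSpan, Submodule.span_le]
  rintro _ ⟨n, hn, rfl⟩
  exact ⟨⟨ratBasis n, ratBasis_mem_H1 n⟩, lminus_ratBasis m hn.1 hn.2, rfl⟩

theorem exists_lminus_eq_zero {m : ℕ} (v : ratSpan m) :
    ∃ u : H1, (u : L2) = v ∧ lminus m u = 0 := by
  obtain ⟨u, hu, huv⟩ := ratSpan_le_map_ker_lminus m v.2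
  exact ⟨u, huv, hu⟩

theorem pointSpectrum_Lminus {m : ℕ} (hm : 1 ≤ m) : pointSpectrum (Lminus m) = {0} := by
  ext z
  rw [mem_pointSpectrum_iff_hasEigenvalue (T := Lminus m) (A := 0) exists_lminus_eq_zero
    fun u z hu => mem_ratSpan_of_lminus_eq hu, Set.mem_singleton_iff]
  have : Nontrivial (ratSpan m) := Module.nontrivial_of_finrank_pos (R := ℂ) (by
    rw [finrank_ratSpan]
    lia)
  refine ⟨fun h => ?_, ?_⟩
  · obtain ⟨u, hu⟩ := h.exists_hasEigenvector
    exact (smul_eq_zero.1 hu.apply_eq_smul.symm).resolve_right hu.2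
  · rintro rfl
    obtain ⟨u, hu⟩ := exists_ne (0 : ratSpan m)
    exact Module.End.hasEigenvalue_of_hasEigenvector
      ⟨Module.End.mem_eigenspace_iff.2 (zero_smul ℂ u).symm, hu⟩

theorem finrank_eigenspace_Lminus (m : ℕ) :
    Module.finrank ℂ (eigenspace (Lminus m) 0) = 2 * m := by
  rw [finrank_eigenspace_eq_finrank_eigenspace (T := Lminus m) (A := 0) exists_lminus_eq_zero
    fun u z hu => mem_ratSpan_of_lminus_eq hu, Module.End.eigenspace_zero, LinearMap.ker_zero,
    finrank_top, finrank_ratSpan]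

theorem opR_mem_ratSpan (m : ℕ) (f : L2) : opR m f ∈ ratSpan m := by
  rw [opR_eq_sum]
  refine Submodule.sum_mem _ fun d hd => ?_
  rcases (abs_le.2 (Finset.mem_Icc.1 hd)).eq_or_lt with hm | hm
  · simp [fejerCoeff, hm]
  · obtain ⟨hlo, hhi⟩ := abs_lt.1 hm
    rw [weightVec_eq]
    exact Submodule.smul_mem _ _ (Submodule.smul_mem _ _
      (sub_mem (ratBasis_mem_ratSpan (by lia) (by lia)) (ratBasis_mem_ratSpan (by lia) hhi)))

/-- The restriction of `L₊` to the span of its eigenfunctions, on which `L₊ = -R`. -/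
def lplusSpan (m : ℕ) : ratSpan m →ₗ[ℂ] ratSpan m :=
  -((opR m).restrict fun f _ => opR_mem_ratSpan m f)

theorem coe_lplusSpan (m : ℕ) (u : ratSpan m) : (lplusSpan m u : L2) = -opR m (u : L2) := rfl

theorem lplusSpan_isSymmetric (m : ℕ) : (lplusSpan m).IsSymmetric := fun u v => by
  rw [Submodule.coe_inner, Submodule.coe_inner, coe_lplusSpan, coe_lplusSpan, inner_neg_left,
    inner_neg_right, opR_symmetric]

theorem exists_lplus_eq_lplusSpan {m : ℕ} (v : ratSpan m) :
    ∃ u : H1, (u : L2) = v ∧ lplus m u = lplusSpan m v := by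
  obtain ⟨u, huv, hu⟩ := exists_lminus_eq_zero v
  rw [lminus_apply, huv] at hu
  exact ⟨u, huv, eq_neg_of_add_eq_zero_left hu⟩

theorem mem_pointSpectrum_Lplus_iff {m : ℕ} {z : ℂ} :
    z ∈ pointSpectrum (Lplus m) ↔ Module.End.HasEigenvalue (lplusSpan m) z :=
  mem_pointSpectrum_iff_hasEigenvalue (T := Lplus m) exists_lplus_eq_lplusSpan
    fun _ _ hu => mem_ratSpan_of_lplus_eq hu

theorem finrank_eigenspace_Lplus (m : ℕ) (z : ℂ) :
    Module.finrank ℂ (eigenspace (Lplus m) z) =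
      Module.finrank ℂ (Module.End.eigenspace (lplusSpan m) z) :=
  finrank_eigenspace_eq_finrank_eigenspace (T := Lplus m) exists_lplus_eq_lplusSpan
    fun _ _ hu => mem_ratSpan_of_lplus_eq hu

theorem lplus_recurrence {m : ℕ} {u : H1} {z : ℂ} (hu : lplus m u = z • (u : L2)) (n : ℤ) :
    2 * z * inner ℂ (ratBasis n) (u : L2) =
      ((m : ℂ) - (|n + 1| : ℤ)) *
          (inner ℂ (ratBasis (n + 1)) (u : L2) - inner ℂ (ratBasis n) (u : L2)) -
        ((m : ℂ) - (|n| : ℤ)) *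
          (inner ℂ (ratBasis n) (u : L2) - inner ℂ (ratBasis (n - 1)) (u : L2)) := by
  have h := lplus_symmetric m ⟨ratBasis n, ratBasis_mem_H1 n⟩ u
  simp only [lplus_ratBasis, hu, inner_smul_left, inner_smul_right, inner_sub_left, map_sub,
    map_natCast, map_intCast, map_div₀, map_one, map_ofNat] at h
  linear_combination -2 * h

-- The off-diagonal entry `m - |n|` of the Jacobi matrix vanishes at `n = -m`, so the first
-- coefficient of an eigenfunction determines all the others.
theorem inner_ratBasis_eq_zero {m : ℕ} {u : H1} {z : ℂ} (hu : lplus m u = z • (u : L2))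
    (h0 : inner ℂ (ratBasis (-m)) (u : L2) = 0) {n : ℤ} (hlo : -m ≤ n) (hhi : n < m) :
    inner ℂ (ratBasis n) (u : L2) = 0 := by
  suffices hstrong : n < m → inner ℂ (ratBasis n) (u : L2) = 0 ∧
      ((m : ℂ) - (|n| : ℤ)) * inner ℂ (ratBasis (n - 1)) (u : L2) = 0 from (hstrong hhi).1
  clear hhi
  induction n, hlo using Int.leInduction with
  | base => simp [h0]
  | succ n hn ih =>
    intro hlt
    obtain ⟨h1, h2⟩ := ih (by lia)
    have hrec := lplus_recurrence hu n
    rw [h1] at hrec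
    rw [add_sub_cancel_right, h1, mul_zero]
    refine ⟨?_, rfl⟩
    have hmul : ((m : ℂ) - (|n + 1| : ℤ)) * inner ℂ (ratBasis (n + 1)) (u : L2) = 0 := by
      linear_combination -hrec - h2
    refine (mul_eq_zero.1 hmul).resolve_left fun h => ?_
    rw [sub_eq_zero, ← Int.cast_natCast, Int.cast_inj] at h
    exact (abs_lt.2 ⟨by lia, hlt⟩ : |n + 1| < m).ne h.symm

theorem eq_zero_of_inner_ratBasis_eq_zero {m : ℕ} {u : H1} {z : ℂ}
    (hu : lplus m u = z • (u : L2)) (h0 : inner ℂ (ratBasis (-m)) (u : L2) = 0) : u = 0 := by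
  have horth : ratSpan m ≤ (Submodule.span ℂ {(u : L2)})ᗮ := by
    rw [ratSpan, Submodule.span_le]
    rintro _ ⟨n, hn, rfl⟩
    rw [SetLike.mem_coe, Submodule.mem_orthogonal_singleton_iff_inner_left]
    exact inner_ratBasis_eq_zero hu h0 hn.1 hn.2
  have h := horth (mem_ratSpan_of_lplus_eq hu)
  rw [Submodule.mem_orthogonal_singleton_iff_inner_left, inner_self_eq_zero] at h
  exact Subtype.ext h

theorem finrank_eigenspace_Lplus_le_one (m : ℕ) (z : ℂ) :
    Module.finrank ℂ (eigenspace (Lplus m) z) ≤ 1 := by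
  let φ : eigenspace (Lplus m) z →ₗ[ℂ] ℂ :=
    (innerSL ℂ (ratBasis (-m)) : L2 →ₗ[ℂ] ℂ) ∘ₗ (Lplus m).domain.subtype ∘ₗ
      (eigenspace (Lplus m) z).subtype
  have hφ : Function.Injective φ := (injective_iff_map_eq_zero φ).2 fun u hu =>
    Subtype.ext (eq_zero_of_inner_ratBasis_eq_zero (mem_eigenspace_iff.1 u.2) hu)
  simpa using LinearMap.finrank_le_finrank_of_injective hφ

theorem re_inner_opR_nonneg (m : ℕ) (f : L2) : 0 ≤ (inner ℂ f (opR m f)).re := by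
  rw [inner_opR, Complex.re_sum]
  refine Finset.sum_nonneg fun d hd => ?_
  rw [← inner_conj_symm, Complex.conj_mul', ← Complex.ofReal_pow, ← Complex.ofReal_mul,
    Complex.ofReal_re]
  exact mul_nonneg (fejerCoeff_nonneg hd) (sq_nonneg _)

theorem nonpos_of_hasEigenvalue_lplusSpan {m : ℕ} {E : ℝ}
    (h : Module.End.HasEigenvalue (lplusSpan m) (E : ℂ)) : E ≤ 0 := by
  obtain ⟨u, hu⟩ := h.exists_hasEigenvector
  have hinner : -inner ℂ (u : L2) (opR m (u : L2)) = (E : ℂ) * (‖(u : L2)‖ : ℂ) ^ 2 := by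
    rw [← inner_neg_right, ← coe_lplusSpan, hu.apply_eq_smul, Submodule.coe_smul,
      inner_smul_right, inner_self_eq_norm_sq_to_K]
    rfl
  have hre := congrArg Complex.re hinner
  rw [Complex.neg_re, ← Complex.ofReal_pow, ← Complex.ofReal_mul, Complex.ofReal_re] at hre
  have hpos : 0 < ‖(u : L2)‖ ^ 2 := by
    have := norm_pos_iff.2 fun h => hu.2 (Subtype.ext h)
    positivity
  exact nonpos_of_mul_nonpos_left (hre ▸ neg_nonpos.2 (re_inner_opR_nonneg m u)) hpos

theorem opR_sum_ratBasis (m : ℕ) : opR m (∑ n ∈ Finset.Ico (-m : ℤ) m, ratBasis n) = 0 := by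
  rw [opR_eq_sum]
  refine Finset.sum_eq_zero fun d hd => ?_
  rcases (abs_le.2 (Finset.mem_Icc.1 hd)).eq_or_lt with hm | hm
  · simp [fejerCoeff, hm]
  · obtain ⟨hlo, hhi⟩ := abs_lt.1 hm
    have hshift (n : ℤ) : d = n + 1 ↔ d - 1 = n := by lia
    simp only [inner_sum, inner_weightVec_ratBasis, hshift]
    rw [← Finset.mul_sum, Finset.sum_sub_distrib, Finset.sum_ite_eq, Finset.sum_ite_eq,
      if_pos (Finset.mem_Ico.2 ⟨by lia, by lia⟩), if_pos (Finset.mem_Ico.2 ⟨by lia, hhi⟩),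
      sub_self, mul_zero, mul_zero, zero_smul]

theorem hasEigenvalue_lplusSpan_zero {m : ℕ} (hm : 1 ≤ m) :
    Module.End.HasEigenvalue (lplusSpan m) 0 := by
  have hmem : ∑ n ∈ Finset.Ico (-m : ℤ) m, ratBasis n ∈ ratSpan m := sum_mem fun n hn =>
    ratBasis_mem_ratSpan (Finset.mem_Ico.1 hn).1 (Finset.mem_Ico.1 hn).2
  refine Module.End.hasEigenvalue_of_hasEigenvector (x := ⟨_, hmem⟩)
    ⟨Module.End.mem_eigenspace_iff.2 (Subtype.ext ?_), fun h => ?_⟩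
  · rw [coe_lplusSpan, opR_sum_ratBasis, neg_zero, zero_smul]
    rfl
  · have hinner := congrArg (fun v : ratSpan m => inner ℂ (ratBasis 0) (v : L2)) h
    have hzero : (0 : ℤ) ∈ Finset.Ico (-m : ℤ) m := Finset.mem_Ico.2 ⟨by lia, by lia⟩
    simp only [inner_sum, inner_ratBasis, Finset.sum_ite_eq, if_pos hzero,
      Submodule.coe_zero, inner_zero_right] at hinner
    exact Real.pi_ne_zero (Complex.ofReal_eq_zero.1 hinner)

theorem exists_eigenvalues_Lplus {m : ℕ} (hm : 1 ≤ m) :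
    ∃ E : Fin (2 * m) → ℝ, StrictMono E ∧ E ⟨2 * m - 1, by lia⟩ = 0 ∧
      pointSpectrum (Lplus m) = Set.range (fun k => (E k : ℂ)) ∧
      ∀ k, Module.finrank ℂ (eigenspace (Lplus m) (E k : ℂ)) = 1 := by
  obtain ⟨E, hmono, hE⟩ := exists_strictMono_eigenvalues (lplusSpan_isSymmetric m)
    (finrank_ratSpan m) fun z =>
      (finrank_eigenspace_Lplus m z).symm.trans_le (finrank_eigenspace_Lplus_le_one m z)
  have hev (k : Fin (2 * m)) : Module.End.HasEigenvalue (lplusSpan m) (E k : ℂ) :=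
    hE.ge ⟨k, rfl⟩
  refine ⟨E, hmono, le_antisymm (nonpos_of_hasEigenvalue_lplusSpan (hev _)) ?_,
    (Set.ext fun z => mem_pointSpectrum_Lplus_iff).trans hE, fun k => ?_⟩
  · obtain ⟨k, hk⟩ := hE.le (hasEigenvalue_lplusSpan_zero hm)
    rw [← Complex.ofReal_eq_zero.1 hk]
    exact hmono.monotone (Fin.mk_le_mk.2 (by lia) : k ≤ ⟨2 * m - 1, by lia⟩)
  · refine le_antisymm (finrank_eigenspace_Lplus_le_one m _) ?_
    rw [finrank_eigenspace_Lplus]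
    exact Module.finrank_pos_iff.2 (Submodule.nontrivial_iff_ne_bot.2 (hev k))

/-! ### The essential spectrum -/

theorem norm_sq_eq_integral_fourier (f : L2) : ‖f‖ ^ 2 = ∫ ξ, ‖(𝓕 f : L2) ξ‖ ^ 2 := by
  have hinner := inner_eq_integral_fourier f f
  simp only [Complex.mul_conj', inner_self_eq_norm_sq_to_K, ← Complex.ofReal_pow] at hinner
  rw [integral_complex_ofReal, ← RCLike.ofReal_pow] at hinner
  exact Complex.ofReal_injective hinner

theorem norm_sq_fourier_le {u v : L2} (h : HasMomentum u v) {M : ℝ}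
    (hu : ∀ᵐ ξ, ‖(𝓕 u : L2) ξ‖ ≤ M) (hv : ∀ᵐ ξ, ‖(𝓕 v : L2) ξ‖ ≤ M) :
    ∀ᵐ ξ, ‖(𝓕 u : L2) ξ‖ ^ 2 ≤ 2 * M ^ 2 * (1 + ξ ^ 2)⁻¹ := by
  filter_upwards [h, hu, hv] with ξ hξ hu hv
  have hmul : |ξ| * ‖(𝓕 u : L2) ξ‖ ≤ M := by
    rw [hξ, norm_mul, Complex.norm_real, Real.norm_eq_abs, abs_mul,
      abs_of_pos Real.two_pi_pos] at hv
    refine le_trans (mul_le_mul_of_nonneg_right ?_ (norm_nonneg _)) hv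
    exact le_mul_of_one_le_left (abs_nonneg ξ) (by linarith [Real.pi_gt_three])
  rw [← div_eq_mul_inv, le_div_iff₀ (by positivity)]
  calc ‖(𝓕 u : L2) ξ‖ ^ 2 * (1 + ξ ^ 2)
      = ‖(𝓕 u : L2) ξ‖ ^ 2 + (|ξ| * ‖(𝓕 u : L2) ξ‖) ^ 2 := by rw [mul_pow, sq_abs]; ring
    _ ≤ M ^ 2 + M ^ 2 := by gcongr
    _ = 2 * M ^ 2 := by ring

theorem tendsto_zero_of_norm_fourier_le {u v : ℕ → L2} (h : ∀ n, HasMomentum (u n) (v n)) {M : ℝ}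
    (hu : ∀ n, ∀ᵐ ξ, ‖(𝓕 (u n) : L2) ξ‖ ≤ M) (hv : ∀ n, ∀ᵐ ξ, ‖(𝓕 (v n) : L2) ξ‖ ≤ M)
    (hlim : ∀ᵐ ξ, Tendsto (fun n => (𝓕 (u n) : L2) ξ) atTop (𝓝 0)) :
    Tendsto u atTop (𝓝 0) := by
  have hint : Tendsto (fun n => ∫ ξ, ‖(𝓕 (u n) : L2) ξ‖ ^ 2) atTop (𝓝 (∫ _ : ℝ, 0)) := by
    refine tendsto_integral_of_dominated_convergence (fun ξ => 2 * M ^ 2 * (1 + ξ ^ 2)⁻¹)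
      (fun n => (Lp.aestronglyMeasurable (𝓕 (u n) : L2)).norm.pow 2)
      (integrable_inv_one_add_sq.const_mul _) (fun n => ?_) ?_
    · filter_upwards [norm_sq_fourier_le (h n) (hu n) (hv n)] with ξ hξ
      rwa [Real.norm_of_nonneg (sq_nonneg _)]
    · filter_upwards [hlim] with ξ hξ
      simpa using hξ.norm.pow 2
  simp only [← norm_sq_eq_integral_fourier, integral_zero] at hint
  rw [tendsto_zero_iff_norm_tendsto_zero]
  simpa using hint.sqrt

namespace IsFourierPair

variable {κ : ℝ → ℂ} {q q₁ : ℝ →ᵇ ℂ}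

theorem conv_eq_inner (h : IsFourierPair κ q) (f : L2) (ξ : ℝ) :
    ∫ η, κ (ξ - η) * f η = inner ℂ ((h.memLp_reflect ξ).toLp _ : L2) f := by
  rw [L2.inner_def]
  refine integral_congr_ae ?_
  filter_upwards [(h.memLp_reflect ξ).coeFn_toLp] with η hη
  rw [hη, RCLike.inner_apply, Complex.conj_conj, mul_comm]

theorem norm_toLp_reflect (h : IsFourierPair κ q) (ξ : ℝ) :
    ‖((h.memLp_reflect ξ).toLp _ : L2)‖ = ‖(h.memLp.toLp κ : L2)‖ := by
  rw [Lp.norm_toLp, Lp.norm_toLp, ← eLpNorm_comp_measurePreserving h.memLp.aestronglyMeasurable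
    (Measure.measurePreserving_sub_left volume ξ)]
  exact congrArg _ (eLpNorm_congr_norm_ae (Eventually.of_forall fun η => RCLike.norm_conj _))

theorem norm_fourier_mulL2_le (h : IsFourierPair κ q) (f : L2) :
    ∀ᵐ ξ, ‖(𝓕 (mulL2 q f) : L2) ξ‖ ≤ ‖(h.memLp.toLp κ : L2)‖ * ‖f‖ := by
  filter_upwards [h.fourier_mulL2 f] with ξ hξ
  rw [hξ, h.conv_eq_inner, ← h.norm_toLp_reflect ξ, ← Lp.norm_fourier_eq f]
  exact norm_inner_le_norm _ _

theorem tendsto_fourier_mulL2 (h : IsFourierPair κ q) {u : ℕ → L2}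
    (hu : ∀ f : L2, Tendsto (fun n => inner ℂ f (u n)) atTop (𝓝 0)) :
    ∀ᵐ ξ, Tendsto (fun n => (𝓕 (mulL2 q (u n)) : L2) ξ) atTop (𝓝 0) := by
  filter_upwards [ae_all_iff.2 fun n => h.fourier_mulL2 (u n)] with ξ hξ
  refine (hu (𝓕⁻ ((h.memLp_reflect ξ).toLp _ : L2))).congr fun n => ?_
  rw [hξ, h.conv_eq_inner, ← Lp.inner_fourier_eq (𝓕⁻ _ : L2), fourier_fourierInv_eq]

theorem tendsto_mulL2 (h : IsFourierPair κ q)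
    (h₁ : IsFourierPair (fun ξ => ((2 * Real.pi * ξ : ℝ) : ℂ) * κ ξ) q₁) {u v : ℕ → L2}
    (huv : ∀ n, HasMomentum (u n) (v n)) {C : ℝ} (hu : ∀ n, ‖u n‖ ≤ C) (hv : ∀ n, ‖v n‖ ≤ C)
    (hweak : ∀ f : L2, Tendsto (fun n => inner ℂ f (u n)) atTop (𝓝 0)) :
    Tendsto (fun n => mulL2 q (u n)) atTop (𝓝 0) := by
  have hC : 0 ≤ C := (norm_nonneg _).trans (hu 0)
  refine tendsto_zero_of_norm_fourier_le (fun n => h.hasMomentum_mulL2 h₁ (huv n))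
    (M := ‖(h.memLp.toLp κ : L2)‖ * C + ‖(h₁.memLp.toLp _ : L2)‖ * C)
    (fun n => ?_) (fun n => ?_) (h.tendsto_fourier_mulL2 hweak)
  · filter_upwards [h.norm_fourier_mulL2_le (u n)] with ξ hξ
    refine hξ.trans ((mul_le_mul_of_nonneg_left (hu n) (norm_nonneg _)).trans ?_)
    exact le_add_of_nonneg_right (by positivity)
  · filter_upwards [h.norm_fourier_mulL2_le (v n), h₁.norm_fourier_mulL2_le (u n),
      coeFn_fourier_add (mulL2 q (v n)) (mulL2 q₁ (u n))] with ξ hv' hu' hadd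
    rw [hadd]
    refine (norm_add_le _ _).trans (add_le_add ?_ ?_)
    · exact hv'.trans (mul_le_mul_of_nonneg_left (hv n) (norm_nonneg _))
    · exact hu'.trans (mul_le_mul_of_nonneg_left (hu n) (norm_nonneg _))

end IsFourierPair

theorem tendsto_weightMul {u : ℕ → H1} (hu : ∀ n, ‖(u n : L2)‖ = 1) {C : ℝ}
    (hC : ∀ n, ‖absNabla (u n)‖ ≤ C)
    (hweak : ∀ f : L2, Tendsto (fun n => inner ℂ f (u n : L2)) atTop (𝓝 0)) :
    Tendsto (fun n => weightMul (u n : L2)) atTop (𝓝 0) := by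
  choose v hv using fun n => exists_hasMomentum (u n)
  have hmul : Tendsto (fun n => mulL2 invAddI (u n : L2)) atTop (𝓝 0) :=
    isFourierPair_expKernel.tendsto_mulL2 isFourierPair_mul_expKernel hv (C := max C 1)
      (fun n => (hu n).trans_le (le_max_right _ _))
      (fun n => ((norm_absNabla_eq (hv n)).symm.trans_le (hC n)).trans (le_max_left _ _)) hweak
  have hstar := ((mulL2 (star invAddI)).continuous.tendsto 0).comp hmul
  rw [map_zero] at hstar
  refine hstar.congr fun n => ?_
  rw [weightMul, mul_comm, mulL2_mul_apply]
  rfl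

theorem continuous_opR (m : ℕ) : Continuous (opR m) := by
  simp only [funext (opR_eq_sum m)]
  fun_prop

theorem tendsto_opR (m : ℕ) {u : ℕ → L2}
    (hweak : ∀ f : L2, Tendsto (fun n => inner ℂ f (u n)) atTop (𝓝 0)) :
    Tendsto (fun n => opR m (u n)) atTop (𝓝 0) := by
  simp only [opR_eq_sum]
  rw [← Finset.sum_const_zero (s := Finset.Icc (-m : ℤ) m)]
  refine tendsto_finsetSum _ fun d _ => ?_
  simpa using ((hweak (weightVec d)).const_mul (fejerCoeff m d : ℂ)).smul_const (weightVec d)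

section RelativelyCompactPerturbation

variable {H : Type*} [NormedAddCommGroup H] [InnerProductSpace ℂ H] {D : Submodule ℂ H}

/-- `K` is relatively compact with respect to `A`, tested on normalized sequences only: it maps
weakly null sequences that are bounded in the graph norm of `A` to null sequences. -/
def IsRelCompact (A : D →ₗ[ℂ] H) (K : H →L[ℂ] H) : Prop :=
  ∀ u : ℕ → D, (∀ n, ‖(u n : H)‖ = 1) → (∃ C, ∀ n, ‖A (u n)‖ ≤ C) →
    (∀ v : H, Tendsto (fun n => inner ℂ v (u n : H)) atTop (𝓝 0)) →
      Tendsto (fun n => K (u n)) atTop (𝓝 0)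

namespace IsRelCompact

variable {A : D →ₗ[ℂ] H} {K : H →L[ℂ] H}

theorem essentialSpectrum_subset (h : IsRelCompact A K) :
    essentialSpectrum ⟨D, A⟩ ⊆ essentialSpectrum ⟨D, A + K ∘ₗ D.subtype⟩ := by
  rintro z ⟨u, hu, hweak, hlim⟩
  refine ⟨u, hu, hweak, ?_⟩
  obtain ⟨C, hC⟩ := (Metric.isBounded_range_of_tendsto _ hlim).exists_norm_le
  have hbound (n : ℕ) : ‖A (u n)‖ ≤ C + ‖z‖ := by
    rw [← sub_add_cancel (A (u n)) (z • (u n : H))]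
    refine norm_add_le_of_le (hC _ ⟨n, rfl⟩) (le_of_eq ?_)
    rw [norm_smul, hu, mul_one]
  rw [← add_zero (0 : H)]
  exact (hlim.add (h u hu ⟨_, hbound⟩ hweak)).congr fun n => sub_add_eq_add_sub _ _ _

theorem neg_add (h : IsRelCompact A K) : IsRelCompact (A + K ∘ₗ D.subtype) (-K) := by
  rintro u hu ⟨C, hC⟩ hweak
  have hbound (n : ℕ) : ‖A (u n)‖ ≤ C + ‖K‖ := by
    rw [← add_sub_cancel_right (A (u n)) (K (u n))]
    refine norm_sub_le_of_le (hC n) ?_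
    simpa [hu] using K.le_opNorm (u n)
  simpa using (h u hu ⟨_, hbound⟩ hweak).neg

theorem essentialSpectrum_add (h : IsRelCompact A K) :
    essentialSpectrum ⟨D, A + K ∘ₗ D.subtype⟩ = essentialSpectrum ⟨D, A⟩ := by
  refine Set.Subset.antisymm ?_ h.essentialSpectrum_subset
  have hsub := h.neg_add.essentialSpectrum_subset
  have hA : A + K ∘ₗ D.subtype + (-K : H →L[ℂ] H) ∘ₗ D.subtype = A := by
    ext u
    simp
  rwa [hA] at hsub

end IsRelCompact

end RelativelyCompactPerturbation

theorem essentialSpectrum_Lplus_eq (m : ℕ) :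
    essentialSpectrum (Lplus m) = essentialSpectrum ⟨H1, absNabla⟩ := by
  have hcompact : IsRelCompact absNabla (-((2 * m : ℂ) • weightMul)) := by
    rintro u hu ⟨C, hC⟩ hweak
    simpa using ((tendsto_weightMul hu hC hweak).const_smul (2 * m : ℂ)).neg
  rw [← hcompact.essentialSpectrum_add]
  have hsum : lplus m = absNabla + (-((2 * m : ℂ) • weightMul) : L2 →L[ℂ] L2) ∘ₗ H1.subtype :=
    LinearMap.ext fun u => (lplus_apply m u).trans (sub_eq_add_neg _ _)
  rw [← hsum]
  rfl

theorem essentialSpectrum_Lminus_eq (m : ℕ) :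
    essentialSpectrum (Lminus m) = essentialSpectrum (Lplus m) :=
  IsRelCompact.essentialSpectrum_add (A := lplus m) (K := ⟨opR m, continuous_opR m⟩)
    fun _ _ _ hweak => tendsto_opR m hweak

section FourierSymbol

variable (u : H1) {z : ℂ}

theorem coeFn_fourier_absNabla_sub :
    ((𝓕 (absNabla u - z • (u : L2)) : L2) : ℝ → ℂ) =ᵐ[volume]
      fun ξ => (absSymbol ξ - z) * (𝓕 (u : L2) : L2) ξ := by
  rw [sub_eq_add_neg, ← neg_smul]
  filter_upwards [coeFn_fourier_add (absNabla u) ((-z) • (u : L2)), coeFn_fourier_absNabla u,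
    coeFn_fourier_smul (-z) (u : L2)] with ξ h1 h2 h3
  rw [h1, h2, h3]
  ring

theorem norm_absNabla_sub_le {ε : ℝ}
    (h : ∀ᵐ ξ, (𝓕 (u : L2) : L2) ξ = 0 ∨ ‖absSymbol ξ - z‖ ≤ ε) :
    ‖absNabla u - z • (u : L2)‖ ≤ ε * ‖(u : L2)‖ := by
  rw [← Lp.norm_fourier_eq, ← Lp.norm_fourier_eq (u : L2)]
  refine Lp.norm_le_mul_norm_of_ae_le_mul ?_
  filter_upwards [coeFn_fourier_absNabla_sub u, h] with ξ hξ hor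
  rw [hξ, norm_mul]
  rcases hor with h0 | hε
  · simp [h0]
  · exact mul_le_mul_of_nonneg_right hε (norm_nonneg _)

theorem mul_norm_le_norm_absNabla_sub {δ : ℝ} (hδ : 0 ≤ δ) (h : ∀ ξ, δ ≤ ‖absSymbol ξ - z‖) :
    δ * ‖(u : L2)‖ ≤ ‖absNabla u - z • (u : L2)‖ := by
  have hle : ‖(δ : ℂ) • (𝓕 (u : L2) : L2)‖ ≤ ‖(𝓕 (absNabla u - z • (u : L2)) : L2)‖ := by
    refine Lp.norm_le_norm_of_ae_le ?_
    filter_upwards [Lp.coeFn_smul (δ : ℂ) (𝓕 (u : L2) : L2),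
      coeFn_fourier_absNabla_sub u] with ξ h1 h2
    rw [h1, h2, Pi.smul_apply, norm_smul, norm_mul, Complex.norm_real, Real.norm_of_nonneg hδ]
    exact mul_le_mul_of_nonneg_right (h ξ) (norm_nonneg _)
  rwa [norm_smul, Lp.norm_fourier_eq, Lp.norm_fourier_eq, Complex.norm_real,
    Real.norm_of_nonneg hδ] at hle

end FourierSymbol

theorem essentialSpectrum_absNabla_subset :
    essentialSpectrum ⟨H1, absNabla⟩ ⊆ Complex.ofReal '' Set.Ici 0 := by
  rintro z ⟨u, hu, -, hlim⟩
  have hclosed : IsClosed (Complex.ofReal '' Set.Ici 0) :=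
    Complex.isometry_ofReal.isClosedEmbedding.isClosedMap _ isClosed_Ici
  rw [hclosed.mem_iff_infDist_zero (Set.nonempty_Ici.image _)]
  have hle (n : ℕ) : Metric.infDist z (Complex.ofReal '' Set.Ici 0) ≤
      ‖absNabla (u n) - z • (u n : L2)‖ := by
    have h := mul_norm_le_norm_absNabla_sub (u n) (z := z)
      (δ := Metric.infDist z (Complex.ofReal '' Set.Ici 0)) Metric.infDist_nonneg fun ξ => by
        rw [← dist_eq_norm, dist_comm]
        exact Metric.infDist_le_dist_of_mem ⟨_, Set.mem_Ici.2 (by positivity), rfl⟩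
    rwa [hu, mul_one] at h
  have hnorm := hlim.norm
  rw [norm_zero] at hnorm
  exact le_antisymm (ge_of_tendsto' hnorm hle) Metric.infDist_nonneg

theorem tendsto_inner_of_orthonormal {𝕜 E : Type*} [RCLike 𝕜] [NormedAddCommGroup E]
    [InnerProductSpace 𝕜 E] {v : ℕ → E} (hv : Orthonormal 𝕜 v) (x : E) :
    Tendsto (fun n => inner 𝕜 x (v n)) atTop (𝓝 0) := by
  have h := (hv.inner_products_summable x).tendsto_atTop_zero.sqrt
  rw [Real.sqrt_zero] at h
  rw [tendsto_zero_iff_norm_tendsto_zero]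
  refine h.congr fun n => ?_
  rw [Real.sqrt_sq (norm_nonneg _), norm_inner_symm]

/-- Disjoint intervals shrinking to `a` from the right, on which a Weyl sequence for `2π|a|`
concentrates in frequency. -/
def weylInterval (a : ℝ) (n : ℕ) : Set ℝ := Set.Ioc (a + 1 / (n + 2)) (a + 1 / (n + 1))

theorem volume_weylInterval (a : ℝ) (n : ℕ) :
    (volume : Measure ℝ).real (weylInterval a n) = 1 / ((n + 1) * (n + 2)) := by
  have h : (1 : ℝ) / (n + 2) ≤ 1 / (n + 1) := by gcongr; norm_num
  rw [weylInterval, Real.volume_real_Ioc_of_le (by linarith)]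
  field_simp
  ring

theorem volume_weylInterval_ne_top (a : ℝ) (n : ℕ) :
    (volume : Measure ℝ) (weylInterval a n) ≠ ∞ :=
  measure_Ioc_lt_top.ne

theorem measurableSet_weylInterval (a : ℝ) (n : ℕ) : MeasurableSet (weylInterval a n) :=
  measurableSet_Ioc

theorem pairwise_disjoint_weylInterval (a : ℝ) :
    Pairwise (Function.onFun Disjoint (weylInterval a)) := by
  refine (pairwise_disjoint_on _).2 fun i j hij => ?_
  refine Set.disjoint_left.2 fun x hi hj => ?_
  have hle : (1 : ℝ) / (j + 1) ≤ 1 / (i + 2) := by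
    have : (i : ℝ) + 1 ≤ j := by exact_mod_cast hij
    exact one_div_le_one_div_of_le (by positivity) (by linarith)
  linarith [hi.1, hj.2]

theorem abs_sub_le_of_mem_weylInterval {a ξ : ℝ} {n : ℕ} (hξ : ξ ∈ weylInterval a n) :
    |ξ - a| ≤ 1 / (n + 1) := by
  have hpos : (0 : ℝ) < 1 / (n + 2) := by positivity
  rw [abs_of_pos (by linarith [hξ.1])]
  linarith [hξ.2]

/-- The `L²`-normalized indicator function of `weylInterval a n`. -/
def weylIndicator (a : ℝ) (n : ℕ) : L2 :=
  indicatorConstLp 2 (measurableSet_weylInterval a n) (volume_weylInterval_ne_top a n)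
    (Real.sqrt ((n + 1) * (n + 2)) : ℂ)

theorem orthonormal_weylIndicator (a : ℝ) : Orthonormal ℂ (weylIndicator a) := by
  refine ⟨fun n => ?_, fun i j hij => ?_⟩
  · rw [weylIndicator, norm_indicatorConstLp (by norm_num) (by norm_num), volume_weylInterval,
      Complex.norm_real, Real.norm_of_nonneg (Real.sqrt_nonneg _), ENNReal.toReal_ofNat,
      ← Real.sqrt_eq_rpow, ← Real.sqrt_mul (by positivity), mul_one_div_cancel (by positivity),
      Real.sqrt_one]
  · refine (L2.inner_indicatorConstLp_indicatorConstLp _ _ (volume_weylInterval_ne_top a i)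
      (volume_weylInterval_ne_top a j) _ _).trans ?_
    rw [(pairwise_disjoint_weylInterval a hij).inter_eq, measureReal_empty, zero_smul]

theorem weylIndicator_eq_zero_or_abs_sub_le (a : ℝ) (n : ℕ) :
    ∀ᵐ ξ, weylIndicator a n ξ = 0 ∨ |ξ - a| ≤ 1 / (n + 1) := by
  have hcoe : weylIndicator a n =ᵐ[volume] (weylInterval a n).indicator _ := indicatorConstLp_coeFn
  filter_upwards [hcoe] with ξ hξ
  by_cases hmem : ξ ∈ weylInterval a n
  · exact Or.inr (abs_sub_le_of_mem_weylInterval hmem)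
  · exact Or.inl (hξ.trans (Set.indicator_of_notMem hmem _))

theorem fourierInv_weylIndicator_mem_H1 (a : ℝ) (n : ℕ) :
    (𝓕⁻ (weylIndicator a n) : L2) ∈ H1 := by
  obtain ⟨v, hv⟩ := exists_hasMomentum_of_ae_eq_zero (u := 𝓕⁻ (weylIndicator a n))
    (R := |a| + 1 / (n + 1)) <| by
      rw [fourier_fourierInv_eq]
      filter_upwards [weylIndicator_eq_zero_or_abs_sub_le a n] with ξ hor hlt
      refine hor.resolve_right fun hle => hlt.not_ge ?_
      linarith [abs_sub_abs_le_abs_sub ξ a]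
  exact hv.mem_H1

theorem absSymbol_mem_essentialSpectrum (a : ℝ) :
    absSymbol a ∈ essentialSpectrum ⟨H1, absNabla⟩ := by
  have horth := orthonormal_weylIndicator a
  refine ⟨fun n => ⟨𝓕⁻ (weylIndicator a n), fourierInv_weylIndicator_mem_H1 a n⟩, fun n => ?_,
    fun f => ?_, ?_⟩
  · rw [← Lp.norm_fourier_eq, fourier_fourierInv_eq, horth.1 n]
  · refine (tendsto_inner_of_orthonormal horth (𝓕 f)).congr fun n => ?_
    rw [← Lp.inner_fourier_eq f, fourier_fourierInv_eq]
  · have hlim : Tendsto (fun n : ℕ => 2 * Real.pi * (1 / ((n : ℝ) + 1))) atTop (𝓝 0) := by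
      simpa using (tendsto_one_div_add_atTop_nhds_zero_nat (𝕜 := ℝ)).const_mul (2 * Real.pi)
    refine squeeze_zero_norm (fun n =>
      (norm_absNabla_sub_le (ε := 2 * Real.pi * (1 / (n + 1))) _ ?_).trans_eq ?_) hlim
    · rw [fourier_fourierInv_eq]
      filter_upwards [weylIndicator_eq_zero_or_abs_sub_le a n] with ξ hor
      refine hor.imp_right fun hle => ?_
      rw [absSymbol, absSymbol, ← Complex.ofReal_sub, Complex.norm_real, ← mul_sub, norm_mul,
        Real.norm_of_nonneg Real.two_pi_pos.le]
      exact mul_le_mul_of_nonneg_left ((abs_abs_sub_abs_le ξ a).trans hle) Real.two_pi_pos.le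
    · rw [← Lp.norm_fourier_eq, fourier_fourierInv_eq, horth.1 n, mul_one]

theorem essentialSpectrum_absNabla :
    essentialSpectrum ⟨H1, absNabla⟩ = Complex.ofReal '' Set.Ici 0 := by
  refine essentialSpectrum_absNabla_subset.antisymm ?_
  rintro _ ⟨l, hl, rfl⟩
  have hsymbol : absSymbol (l / (2 * Real.pi)) = l := by
    rw [absSymbol, abs_of_nonneg (div_nonneg hl Real.two_pi_pos.le),
      mul_div_cancel₀ _ Real.two_pi_pos.ne']
  exact hsymbol ▸ absSymbol_mem_essentialSpectrum _

end HalfWave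

end

theorem theorem4 (m : ℕ) (hm : 1 ≤ m) :
    -- the point spectrum of `L₊`
    (∃ E : Fin (2 * m) → ℝ, StrictMono E ∧ E ⟨2 * m - 1, by omega⟩ = 0 ∧
      HalfWave.pointSpectrum (HalfWave.Lplus m) = Set.range (fun k => (E k : ℂ)) ∧
      ∀ k, Module.finrank ℂ (HalfWave.eigenspace (HalfWave.Lplus m) (E k : ℂ)) = 1) ∧
    -- the point spectrum of `L₋`
    (HalfWave.pointSpectrum (HalfWave.Lminus m) = {0} ∧
      Module.finrank ℂ (HalfWave.eigenspace (HalfWave.Lminus m) 0) = 2 * m) ∧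
    -- the essential spectra, and the absence of embedded eigenvalues
    (HalfWave.essentialSpectrum (HalfWave.Lplus m) = Complex.ofReal '' Set.Ici 0 ∧
      HalfWave.essentialSpectrum (HalfWave.Lminus m) = Complex.ofReal '' Set.Ici 0 ∧
      ∀ E : ℝ, 0 < E → (E : ℂ) ∉ HalfWave.pointSpectrum (HalfWave.Lplus m) ∧
        (E : ℂ) ∉ HalfWave.pointSpectrum (HalfWave.Lminus m)) := by
  obtain ⟨E, hmono, hzero, hspec, hsimple⟩ := HalfWave.exists_eigenvalues_Lplus hm
  have hLminus := HalfWave.pointSpectrum_Lminus hm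
  have hess : HalfWave.essentialSpectrum (HalfWave.Lplus m) = Complex.ofReal '' Set.Ici 0 :=
    (HalfWave.essentialSpectrum_Lplus_eq m).trans HalfWave.essentialSpectrum_absNabla
  refine ⟨⟨E, hmono, hzero, hspec, hsimple⟩,
    ⟨hLminus, HalfWave.finrank_eigenspace_Lminus m⟩,
    hess, (HalfWave.essentialSpectrum_Lminus_eq m).trans hess, fun l hl => ⟨?_, ?_⟩⟩
  · rw [hspec]
    rintro ⟨k, hk⟩
    have hk_le : E k ≤ 0 := (hmono.monotone (Fin.le_def.2 (by lia))).trans_eq hzero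
    exact hl.not_ge (Complex.ofReal_injective hk ▸ hk_le)
  · rw [hLminus, Set.mem_singleton_iff, Complex.ofReal_eq_zero]
    exact hl.ne'
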